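/- \textbf{Theorem 2.} \emph{Model.} Let $n,m\ge 1$ and $T\ge n$ be integers. For each agent $i\in[n]$ and item $e\in[m]$ let $D_{ie}$ be a probability distribution on $[0,1]$ with mean $\mu_{ie}$, and let $v^t_{ie}$ ($1\le t\le T$, $i\in[n]$, $e\in[m]$) be mutually independent random variables with $v^t_{ie}\sim D_{ie}$. An allocation is a matrix $a\in\{0,1\}^{n\times m}$ with $\sum_i a_{ie}=1$ for every $e$. In each round $t$ an algorithm chooses an allocation $a^t$ that depends only on the previous allocations and feedback (and possibly on internal randomness, independent of all values), and then observes $v^t_{ie}$ for those $(i,e)$ with $a^t_{ie}=1$. Let the (deterministic) allocations $x^1,\dots,x^T$ maximize $\min_i\sum_{t=1}^T\sum_e\mu_{ie}x^t_{ie}$ over all sequences of $T$ allocations. The regret is $$R_T=\mathbb E\Bigl[\min_{i}\sum_{t=1}^T\sum_{e}v^t_{ie}x^t_{ie}-\min_{i}\sum_{t=1}^T\sum_{e}v^t_{ie}a^t_{ie}\Bigr].$$ \emph{Algorithm 1 (parameters $\epsilon$ and $C_{\rm rad}$).} In round $t=1,\dots,n$ assign all items to agent $t$. Put $u^n_i=0$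 for all $i$. In round $t=n+1,\dots,T$, let $N_{ie}$ be the number of earlier rounds in which agent $i$ received item $e$, let $\hat v_{ie}$ be the average of the $N_{ie}$ values observed in them, and let $$\bar v^t_{ie}=\hat v_{ie}+\sqrt{C_{\rm rad}\hat v_{ie}/N_{ie}}+C_{\rm rad}/N_{ie};$$ choose an allocation $a^t$ maximizing $\sum_{i,e}(1-\epsilon)^{u_i^{t-1}/m}\,\bar v^t_{ie}\,a_{ie}$ over all allocations $a$ (ties broken arbitrarily), and put $u_i^t=u_i^{t-1}+\sum_e\bar v^t_{ie}a^t_{ie}$. If $\epsilon\ge 1$, this rule is replaced by an arbitrary choice of $a^t$. \emph{Claim.} Run Algorithm 1 with $\epsilon=\sqrt{n\ln n/T}$ and with $C_{\rm rad}=\Theta(\ln(mnT))$, the constant in the lower bound being sufficiently large. Then $$R_T=O\!\left(m\sqrt{\frac{T\ln n}{n}}+m\sqrt{T\ln T}+\sqrt{C_{\rm rad}\,m^2T}+C_{\rm rad}\,m\ln T\right).$$ Precisely: there is an absolute constant $c_0>0$ such that for every $c\ge c_0$ there is a constant $K>0$, depending only on $c$, such that for all $n,m\ge1$, all $T\ge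 n$, all distributions $D_{ie}$, every $C_{\rm rad}$ with $c_0\ln(mnT)\le C_{\rm rad}\le c\ln(mnT)$ and every tie-breaking, $$|R_T|\le K\left(m\sqrt{\frac{T\ln n}{n}}+m\sqrt{T\ln T}+\sqrt{C_{\rm rad}\,m^2T}+C_{\rm rad}\,m\ln T\right).$$ -/

import Mathlib

open MeasureTheory ProbabilityTheory

noncomputable section

namespace BMMFA

/-- An allocation of `m` items to `n` agents, given as the map sending an item to the agent who
receives it. These maps correspond bijectively to the `0`-`1` matrices `a` of size `n × m` with
`∑ i, a i e = 1` for every item `e`. -/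
abbrev Allocation (n m : ℕ) : Type := Fin m → Fin n

/-- The `0`-`1` matrix of an allocation: the entry is `1` iff agent `i` receives item `e`. -/
def Allocation.mat {n m : ℕ} (a : Allocation n m) (i : Fin n) (e : Fin m) : ℝ :=
  if a e = i then 1 else 0

/-- Egalitarian social welfare over `T` rounds (numbered `0, …, T - 1`) of the allocation sequence
`a` when `w t i e` is the value of item `e` for agent `i` in round `t`:
`min_i ∑_t ∑_e w t i e * a t i e`. -/
def welfare {n m : ℕ} (T : ℕ) (w : ℕ → Fin n → Fin m → ℝ) (a : ℕ → Allocation n m) : ℝ :=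
  ⨅ i : Fin n, ∑ t ∈ Finset.range T, ∑ e : Fin m, w t i e * (a t).mat i e

/-- The expected values `μ i e` of the distributions `D i e`. -/
def meanValue {n m : ℕ} (D : Fin n → Fin m → Measure ℝ) (i : Fin n) (e : Fin m) : ℝ :=
  ∫ z, z ∂(D i e)

/-- `x` is the sequence of allocations of an optimal policy: it maximizes the egalitarian social
welfare with respect to the expected values `μ`, over all sequences of allocations. -/
def IsOptimalPolicy {n m : ℕ} (T : ℕ) (μ : Fin n → Fin m → ℝ) (x : ℕ → Allocation n m) : Prop :=
  ∀ y : ℕ → Allocation n m, welfare T (fun _ => μ) y ≤ welfare T (fun _ => μ) x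

/-- The random item values: the `D i e` are probability distributions on `[0, 1]`, each `v t i e`
(`t < T`) has distribution `D i e`, and all of these random variables are mutually independent. -/
structure IsValueModel {n m : ℕ} {Ω : Type*} [MeasurableSpace Ω] (P : Measure Ω) (T : ℕ)
    (D : Fin n → Fin m → Measure ℝ) (v : ℕ → Fin n → Fin m → Ω → ℝ) : Prop where
  isProb : ∀ i e, IsProbabilityMeasure (D i e)
  mem_Icc : ∀ i e, ∀ᵐ z ∂(D i e), z ∈ Set.Icc (0 : ℝ) 1
  measurable : ∀ t < T, ∀ i e, Measurable (v t i e)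
  law : ∀ t < T, ∀ i e, P.map (v t i e) = D i e
  indep : iIndepFun (fun p : Fin T × Fin n × Fin m => v p.1 p.2.1 p.2.2) P

/-- The information revealed before round `t`: the allocations of the earlier rounds `s < t`
and their semi-bandit feedback, i.e. the values `v s i e` for those `(i, e)` such that agent `i`
received item `e` in round `s`. -/
@[reducible] def history {n m : ℕ} {Ω : Type*} (v : ℕ → Fin n → Fin m → Ω → ℝ)
    (a : ℕ → Ω → Allocation n m) (t : ℕ) : MeasurableSpace Ω :=
  ⨆ (s : ℕ) (_ : s < t),
    (MeasurableSpace.comap (a s) inferInstance ⊔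
      MeasurableSpace.comap (fun ω (e : Fin m) => v s (a s ω e) e ω) inferInstance)

/-- The allocation of every round depends only on the earlier allocations and their feedback, and
possibly on internal randomness `𝒢` (used to break ties) that is independent of all values. -/
def IsNonanticipating {n m : ℕ} {Ω : Type*} [mΩ : MeasurableSpace Ω] (P : Measure Ω) (T : ℕ)
    (v : ℕ → Fin n → Fin m → Ω → ℝ) (a : ℕ → Ω → Allocation n m) : Prop :=
  ∃ 𝒢 : MeasurableSpace Ω, 𝒢 ≤ mΩ ∧
    Indep 𝒢 (⨆ p : Fin T × Fin n × Fin m,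
      MeasurableSpace.comap (v p.1 p.2.1 p.2.2) inferInstance) P ∧
    ∀ t < T, Measurable[𝒢 ⊔ history v a t] (a t)

/-! Quantities computed by the algorithm, for one realization `v` of the values and `a` of the
allocations. -/

/-- The number of rounds before round `t` in which agent `i` received item `e`. -/
def count {n m : ℕ} (a : ℕ → Allocation n m) (t : ℕ) (i : Fin n) (e : Fin m) : ℕ :=
  ((Finset.range t).filter (fun s => a s e = i)).card

/-- The average of the samples for `(i, e)` observed before round `t`. -/
def empMean {n m : ℕ} (v : ℕ → Fin n → Fin m → ℝ) (a : ℕ → Allocation n m) (t : ℕ)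
    (i : Fin n) (e : Fin m) : ℝ :=
  (∑ s ∈ (Finset.range t).filter (fun s => a s e = i), v s i e) / (count a t i e : ℝ)

/-- The confidence radius. -/
def rad (C x : ℝ) (N : ℕ) : ℝ := √(C * x / N) + C / N

/-- The upper confidence bound for `(i, e)` used in round `t`. -/
def ucb {n m : ℕ} (C : ℝ) (v : ℕ → Fin n → Fin m → ℝ) (a : ℕ → Allocation n m) (t : ℕ)
    (i : Fin n) (e : Fin m) : ℝ :=
  empMean v a t i e + rad C (empMean v a t i e) (count a t i e)

/-- The utility, measured by upper confidence bounds, that agent `i` accumulated before round `t`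
in the rounds following the `n` initial ones. -/
def ucbUtility {n m : ℕ} (C : ℝ) (v : ℕ → Fin n → Fin m → ℝ) (a : ℕ → Allocation n m) (t : ℕ)
    (i : Fin n) : ℝ :=
  ∑ s ∈ Finset.Ico n t, ∑ e : Fin m, ucb C v a s i e * (a s).mat i e

/-- The quantity that the allocation `b` of round `t` has to maximize. -/
def objective {n m : ℕ} (ε C : ℝ) (v : ℕ → Fin n → Fin m → ℝ) (a : ℕ → Allocation n m) (t : ℕ)
    (b : Allocation n m) : ℝ :=
  ∑ i : Fin n, ∑ e : Fin m,
    (1 - ε) ^ (1 / (m : ℝ) * ucbUtility C v a t i) * ucb C v a t i e * b.mat i e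

/-- `a` is an execution of the allocation algorithm with parameter `ε` and constant `C` over `T`
rounds, when the realized values are `v`. In each of the first `n` rounds all items go to one
agent, a different one each time; every later allocation maximizes the objective. Ties may be
broken arbitrarily. The objective is meaningful only for `ε < 1`; for `ε ≥ 1` no
restriction is put on the later allocations. -/
structure IsExecution {n m : ℕ} (ε C : ℝ) (T : ℕ) (v : ℕ → Fin n → Fin m → ℝ)
    (a : ℕ → Allocation n m) : Prop where
  initial : ∀ t < T, ∀ h : t < n, ∀ e, a t e = ⟨t, h⟩
  later : ∀ t < T, n ≤ t → ε < 1 → ∀ b : Allocation n m,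
    objective ε C v a t b ≤ objective ε C v a t (a t)

/-- The expected regret `R_T = E[OPT - ALG]` of the random allocations `a` against the
(deterministic) allocations `x` of an optimal policy. -/
def regret {n m : ℕ} {Ω : Type*} [MeasurableSpace Ω] (P : Measure Ω) (T : ℕ)
    (v : ℕ → Fin n → Fin m → Ω → ℝ) (x : ℕ → Allocation n m) (a : ℕ → Ω → Allocation n m) : ℝ :=
  ∫ ω, (welfare T (fun t i e => v t i e ω) x -
    welfare T (fun t i e => v t i e ω) (fun t => a t ω)) ∂P

end BMMFA

end

namespace BMMFA

variable {n m : ℕ}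

/-! ### Elementary inequalities -/

/-! The algorithm runs multiplicative weights over the agents on optimistic estimates. On a clean
event all sampled sums are close to their means. Then every upper confidence bound dominates its
mean (`IsClean.le_ucb`), and the optimistic utility of an agent exceeds its mean utility by at most
4m√(CT) + mC(1 + log T) (`IsClean.ucbUtility_le`).

The potential is ∑ᵢ (1-ε)^(uᵢ/m). The objective splits over items, so each item goes to an agent
with the largest weighted bound. By optimism this choice beats the time average of the optimal
policy, a fractional allocation giving every agent mean utility at least OPT/T per round. Up to
lower-order terms, each round therefore shrinks the potential by a factor exp(-ε·OPT/(mT))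
(`IsExecution.potential_le`). One agent's term is at most the whole potential, so taking logarithms
bounds each agent's shortfall by O(ε·OPT + m log n/ε) plus corrections
(`IsExecution.le_ucbUtility`). Since OPT ≤ mT/n, the choice ε = √(n log n/T) balances the two terms.
Gains above 3 occur only for pairs with fewer than C samples, at total cost nm(C+1).

The samples are collected adaptively, so concentration comes from an exponential supermartingale
(`IsValueModel.lintegral_expWeight_le`), Markov's inequality and a union bound. Off the clean event,
and when ε > 1/2 or T < n²C, the trivial bound mT/n on the welfare difference suffices. -/

theorem exp_neg_le_quadratic {x : ℝ} (hx : 0 ≤ x) : Real.exp (-x) ≤ 1 - x + x ^ 2 / 2 := by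
  have h := Real.quadratic_le_exp_of_nonneg hx
  have hp : 0 < 1 + x + x ^ 2 / 2 := by positivity
  rw [Real.exp_neg]
  calc (Real.exp x)⁻¹ ≤ (1 + x + x ^ 2 / 2)⁻¹ := inv_anti₀ hp h
    _ ≤ 1 - x + x ^ 2 / 2 := by
      rw [inv_le_iff_one_le_mul₀ hp]
      -- (1 + x + x²/2)(1 - x + x²/2) = 1 + x⁴/4.
      nlinarith [sq_nonneg (x ^ 2)]

/-- The term k = 0 is 1/0 = 0, so this is a harmonic sum. -/
theorem sum_range_inv_le {T : ℕ} (hT : 1 ≤ T) :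
    ∑ k ∈ Finset.range T, (1 : ℝ) / k ≤ 1 + Real.log T := by
  have h := harmonic_le_one_add_log T
  refine le_trans ?_ h
  obtain ⟨N, rfl⟩ : ∃ N, T = N + 1 := ⟨T - 1, by omega⟩
  rw [Finset.sum_range_succ', harmonic, Finset.sum_range_succ]
  push_cast
  have : (0 : ℝ) ≤ ((N : ℝ) + 1)⁻¹ := by positivity
  simpa using this

theorem sum_range_succ_inv_sqrt_le (T : ℕ) :
    ∑ k ∈ Finset.range (T + 1), √(1 / (k : ℝ)) ≤ 2 * √T := by
  induction T with
  | zero => simp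
  | succ k ih =>
    rw [Finset.sum_range_succ]
    refine (add_le_add ih le_rfl).trans ?_
    have hk : (0 : ℝ) ≤ k := Nat.cast_nonneg k
    push_cast
    have h0 : 0 < √((k : ℝ) + 1) := Real.sqrt_pos.2 (by linarith)
    have h1 : √(k : ℝ) ^ 2 = k := Real.sq_sqrt hk
    have h2 : √((k : ℝ) + 1) ^ 2 = k + 1 := Real.sq_sqrt (by linarith)
    rw [Real.sqrt_div zero_le_one, Real.sqrt_one]
    have h3 : 1 / √((k : ℝ) + 1) * √((k : ℝ) + 1) = 1 := by field_simp
    refine le_of_mul_le_mul_right ?_ h0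
    rw [add_mul, h3]
    -- After multiplication by √(k+1) the claim is 2√k√(k+1) + 1 ≤ 2(k+1), that is (√(k+1) - √k)² ≥
    -- 0.
    nlinarith [sq_nonneg (√((k : ℝ) + 1) - √(k : ℝ))]

theorem sum_range_inv_sqrt_le (T : ℕ) :
    ∑ k ∈ Finset.range T, √(1 / (k : ℝ)) ≤ 2 * √T :=
  (Finset.sum_le_sum_of_subset_of_nonneg (Finset.range_subset_range.2 T.le_succ)
    fun _ _ _ => Real.sqrt_nonneg _).trans (sum_range_succ_inv_sqrt_le T)

/-! ### Sums over the rounds in which an agent receives an item -/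

/-- The sum of the samples for `(i, e)` observed before round `t`. -/
def sampleSum (v : ℕ → Fin n → Fin m → ℝ) (a : ℕ → Allocation n m) (t : ℕ)
    (i : Fin n) (e : Fin m) : ℝ :=
  ∑ s ∈ (Finset.range t).filter (fun s => a s e = i), v s i e

theorem sum_mul_mat (f : Fin n → ℝ) (b : Allocation n m) (e : Fin m) :
    ∑ i, f i * b.mat i e = f (b e) := by
  simp [Allocation.mat]

theorem sum_mat (b : Allocation n m) (e : Fin m) : ∑ i, b.mat i e = 1 := by
  simp [Allocation.mat]

theorem mat_nonneg (b : Allocation n m) (i : Fin n) (e : Fin m) : 0 ≤ b.mat i e := by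
  unfold Allocation.mat; split_ifs <;> norm_num

theorem sum_sum_mul_mat (s : Finset ℕ) (w : ℕ → Fin n → Fin m → ℝ) (a : ℕ → Allocation n m)
    (i : Fin n) :
    ∑ t ∈ s, ∑ e, w t i e * (a t).mat i e
      = ∑ e, ∑ t ∈ s.filter (fun t => a t e = i), w t i e := by
  rw [Finset.sum_comm]
  refine Finset.sum_congr rfl fun e _ => ?_
  rw [Finset.sum_filter]
  exact Finset.sum_congr rfl fun t _ => by simp [Allocation.mat]

theorem count_succ (a : ℕ → Allocation n m) (t : ℕ) (i : Fin n) (e : Fin m) :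
    count a (t + 1) i e = count a t i e + if a t e = i then 1 else 0 := by
  unfold count
  rw [Finset.range_add_one, Finset.filter_insert]
  split_ifs with h
  · rw [Finset.card_insert_of_notMem (by simp)]
  · simp

theorem sampleSum_succ (v : ℕ → Fin n → Fin m → ℝ) (a : ℕ → Allocation n m) (t : ℕ)
    (i : Fin n) (e : Fin m) :
    sampleSum v a (t + 1) i e = sampleSum v a t i e + if a t e = i then v t i e else 0 := by
  unfold sampleSum
  rw [Finset.range_add_one, Finset.filter_insert]
  split_ifs with h
  · rw [Finset.sum_insert (by simp), add_comm]
  · simp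

theorem count_le (a : ℕ → Allocation n m) (t : ℕ) (i : Fin n) (e : Fin m) :
    count a t i e ≤ t := by
  unfold count
  exact (Finset.card_filter_le _ _).trans (by simp)

/-- Along the rounds in which i receives e, the count runs through 0, 1, 2, … once each. This turns
sums of confidence radii over time into sums over sample sizes. -/
theorem sum_filter_count (a : ℕ → Allocation n m) (i : Fin n) (e : Fin m) (g : ℕ → ℝ) (T : ℕ) :
    ∑ t ∈ (Finset.range T).filter (fun t => a t e = i), g (count a t i e)
      = ∑ k ∈ Finset.range (count a T i e), g k := by
  induction T with
  | zero => simp [count]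
  | succ T ih =>
    rw [Finset.range_add_one, Finset.filter_insert, count_succ]
    split_ifs with h
    · rw [Finset.sum_insert (by simp), ih, Finset.sum_range_succ, add_comm]
    · simpa using ih

theorem sum_filter_Ico_count_le (a : ℕ → Allocation n m) (i : Fin n) (e : Fin m) {g : ℕ → ℝ}
    (hg : ∀ k, 0 ≤ g k) (r T : ℕ) :
    ∑ t ∈ (Finset.Ico r T).filter (fun t => a t e = i), g (count a t i e)
      ≤ ∑ k ∈ Finset.range T, g k := by
  calc _ ≤ ∑ t ∈ (Finset.range T).filter (fun t => a t e = i), g (count a t i e) := by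
        refine Finset.sum_le_sum_of_subset_of_nonneg ?_ fun _ _ _ => hg _
        exact Finset.filter_subset_filter _ fun t ht => by
          simp only [Finset.mem_Ico, Finset.mem_range] at ht ⊢; exact ht.2
    _ = ∑ k ∈ Finset.range (count a T i e), g k := sum_filter_count a i e g T
    _ ≤ _ := Finset.sum_le_sum_of_subset_of_nonneg
        (Finset.range_subset_range.2 (count_le a T i e)) fun _ _ _ => hg _

theorem sampleSum_nonneg {v : ℕ → Fin n → Fin m → ℝ} {T : ℕ}
    (hv : ∀ t < T, ∀ i e, v t i e ∈ Set.Icc (0 : ℝ) 1) (a : ℕ → Allocation n m) {t : ℕ}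
    (ht : t ≤ T) (i : Fin n) (e : Fin m) : 0 ≤ sampleSum v a t i e :=
  Finset.sum_nonneg fun s hs => (hv s (by
    simp only [Finset.mem_filter, Finset.mem_range] at hs; omega) i e).1

theorem sampleSum_le_count {v : ℕ → Fin n → Fin m → ℝ} {T : ℕ}
    (hv : ∀ t < T, ∀ i e, v t i e ∈ Set.Icc (0 : ℝ) 1) (a : ℕ → Allocation n m) {t : ℕ}
    (ht : t ≤ T) (i : Fin n) (e : Fin m) : sampleSum v a t i e ≤ count a t i e := by
  have := Finset.sum_le_card_nsmul ((Finset.range t).filter (fun s => a s e = i))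
    (fun s => v s i e) 1 fun s hs => (hv s (by
      simp only [Finset.mem_filter, Finset.mem_range] at hs; omega) i e).2
  simpa [sampleSum, count] using this

/-! ### Welfare -/

theorem welfare_le [NeZero n] (T : ℕ) (w : ℕ → Fin n → Fin m → ℝ) (a : ℕ → Allocation n m)
    (i : Fin n) :
    welfare T w a ≤ ∑ t ∈ Finset.range T, ∑ e : Fin m, w t i e * (a t).mat i e :=
  ciInf_le (Set.finite_range _).bddBelow i

theorem le_welfare [NeZero n] {T : ℕ} {w : ℕ → Fin n → Fin m → ℝ} {a : ℕ → Allocation n m}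
    {B : ℝ} (h : ∀ i, B ≤ ∑ t ∈ Finset.range T, ∑ e : Fin m, w t i e * (a t).mat i e) :
    B ≤ welfare T w a :=
  le_ciInf h

/-- The minimum is at most the average over agents, and each round distributes total value at most
m. -/
theorem welfare_mem_Icc [NeZero n] {T : ℕ} {w : ℕ → Fin n → Fin m → ℝ}
    (hw : ∀ t < T, ∀ i e, w t i e ∈ Set.Icc (0 : ℝ) 1) (a : ℕ → Allocation n m) :
    welfare T w a ∈ Set.Icc 0 ((m : ℝ) * T / n) := by
  constructor
  · exact le_welfare fun i => Finset.sum_nonneg fun t ht => Finset.sum_nonneg fun e _ =>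
      mul_nonneg (hw t (Finset.mem_range.1 ht) i e).1 (mat_nonneg _ _ _)
  · have hn : (0 : ℝ) < n := by exact_mod_cast Nat.pos_of_ne_zero (NeZero.ne n)
    rw [le_div_iff₀ hn, mul_comm]
    calc (n : ℝ) * welfare T w a = ∑ _i : Fin n, welfare T w a := by simp
      _ ≤ ∑ i : Fin n, ∑ t ∈ Finset.range T, ∑ e : Fin m, w t i e * (a t).mat i e :=
        Finset.sum_le_sum fun i _ => welfare_le T w a i
      _ = ∑ t ∈ Finset.range T, ∑ e : Fin m, w t (a t e) e := by
        rw [Finset.sum_comm]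
        refine Finset.sum_congr rfl fun t _ => ?_
        rw [Finset.sum_comm]
        exact Finset.sum_congr rfl fun e _ => sum_mul_mat (fun i => w t i e) (a t) e
      _ ≤ ∑ t ∈ Finset.range T, ∑ _e : Fin m, (1 : ℝ) :=
        Finset.sum_le_sum fun t ht => Finset.sum_le_sum fun e _ =>
          (hw t (Finset.mem_range.1 ht) _ e).2
      _ = (m : ℝ) * T := by simp [mul_comm]

theorem abs_welfare_sub_le [NeZero n] {T : ℕ} {w : ℕ → Fin n → Fin m → ℝ}
    (hw : ∀ t < T, ∀ i e, w t i e ∈ Set.Icc (0 : ℝ) 1) (a b : ℕ → Allocation n m) :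
    |welfare T w a - welfare T w b| ≤ (m : ℝ) * T / n := by
  have h1 := welfare_mem_Icc hw a
  have h2 := welfare_mem_Icc hw b
  rw [abs_le]
  constructor <;> linarith [h1.1, h1.2, h2.1, h2.2]

/-! ### The clean event and its effect on welfare -/

/-- All empirical sums up to round `T` are close to their means. -/
def IsClean (C : ℝ) (T : ℕ) (μ : Fin n → Fin m → ℝ) (v : ℕ → Fin n → Fin m → ℝ)
    (a : ℕ → Allocation n m) : Prop :=
  ∀ t ≤ T, ∀ i e,
    count a t i e * μ i e ≤ sampleSum v a t i e + √(C * sampleSum v a t i e) + C ∧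
    sampleSum v a t i e ≤ count a t i e * μ i e + √(C * count a t i e)

theorem sum_sum_const_mul_mat (T : ℕ) (μ : Fin n → Fin m → ℝ) (a : ℕ → Allocation n m)
    (i : Fin n) :
    ∑ t ∈ Finset.range T, ∑ e, μ i e * (a t).mat i e = ∑ e, count a T i e * μ i e := by
  rw [sum_sum_mul_mat _ (fun _ => μ)]
  simp [count]

theorem IsClean.agent_le {C : ℝ} {T : ℕ} {μ : Fin n → Fin m → ℝ} {v : ℕ → Fin n → Fin m → ℝ}
    {a : ℕ → Allocation n m} (h : IsClean C T μ v a) (hC : 0 ≤ C) (i : Fin n) :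
    ∑ t ∈ Finset.range T, ∑ e, v t i e * (a t).mat i e
      ≤ ∑ t ∈ Finset.range T, ∑ e, μ i e * (a t).mat i e + m * √(C * T) := by
  rw [sum_sum_const_mul_mat, sum_sum_mul_mat]
  calc _ ≤ ∑ e, (count a T i e * μ i e + √(C * T)) := by
        refine Finset.sum_le_sum fun e _ => ((h T le_rfl i e).2).trans ?_
        gcongr
        exact count_le a T i e
    _ = _ := by simp [Finset.sum_add_distrib]

theorem IsClean.le_agent {C : ℝ} {T : ℕ} {μ : Fin n → Fin m → ℝ} {v : ℕ → Fin n → Fin m → ℝ}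
    {a : ℕ → Allocation n m} (h : IsClean C T μ v a) (hC : 0 ≤ C)
    (hv : ∀ t < T, ∀ i e, v t i e ∈ Set.Icc (0 : ℝ) 1) (i : Fin n) :
    ∑ t ∈ Finset.range T, ∑ e, μ i e * (a t).mat i e
      ≤ ∑ t ∈ Finset.range T, ∑ e, v t i e * (a t).mat i e + m * √(C * T) + m * C := by
  rw [sum_sum_const_mul_mat, sum_sum_mul_mat]
  calc _ ≤ ∑ e, (sampleSum v a T i e + √(C * T) + C) := by
        refine Finset.sum_le_sum fun e _ => ((h T le_rfl i e).1).trans ?_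
        gcongr
        refine (sampleSum_le_count hv a le_rfl i e).trans ?_
        exact_mod_cast count_le a T i e
    _ = _ := by simp [Finset.sum_add_distrib, sampleSum]

theorem IsClean.welfare_le [NeZero n] {C : ℝ} {T : ℕ} {μ : Fin n → Fin m → ℝ}
    {v : ℕ → Fin n → Fin m → ℝ} {a : ℕ → Allocation n m} (h : IsClean C T μ v a) (hC : 0 ≤ C) :
    welfare T v a ≤ welfare T (fun _ => μ) a + m * √(C * T) := by
  rw [← sub_le_iff_le_add]
  refine le_welfare fun i => ?_
  linarith [h.agent_le hC i, BMMFA.welfare_le T v a i]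

theorem IsClean.le_welfare [NeZero n] {C : ℝ} {T : ℕ} {μ : Fin n → Fin m → ℝ}
    {v : ℕ → Fin n → Fin m → ℝ} {a : ℕ → Allocation n m} (h : IsClean C T μ v a) (hC : 0 ≤ C)
    (hv : ∀ t < T, ∀ i e, v t i e ∈ Set.Icc (0 : ℝ) 1) :
    welfare T (fun _ => μ) a - m * √(C * T) - m * C ≤ welfare T v a := by
  refine BMMFA.le_welfare fun i => ?_
  linarith [h.le_agent hC hv i, BMMFA.welfare_le T (fun _ => μ) a i]

/-! ### The upper confidence bounds -/

theorem empMean_eq (v : ℕ → Fin n → Fin m → ℝ) (a : ℕ → Allocation n m) (t : ℕ)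
    (i : Fin n) (e : Fin m) : empMean v a t i e = sampleSum v a t i e / count a t i e := rfl

theorem empMean_mem_Icc {v : ℕ → Fin n → Fin m → ℝ} {T : ℕ}
    (hv : ∀ t < T, ∀ i e, v t i e ∈ Set.Icc (0 : ℝ) 1) (a : ℕ → Allocation n m) {t : ℕ}
    (ht : t ≤ T) (i : Fin n) (e : Fin m) : empMean v a t i e ∈ Set.Icc (0 : ℝ) 1 := by
  rw [empMean_eq]
  exact ⟨div_nonneg (sampleSum_nonneg hv a ht i e) (Nat.cast_nonneg _),
    div_le_one_of_le₀ (sampleSum_le_count hv a ht i e) (Nat.cast_nonneg _)⟩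

theorem rad_nonneg {C : ℝ} (hC : 0 ≤ C) (x : ℝ) (N : ℕ) : 0 ≤ rad C x N := by
  unfold rad; positivity

theorem ucb_nonneg {C : ℝ} (hC : 0 ≤ C) {v : ℕ → Fin n → Fin m → ℝ} {T : ℕ}
    (hv : ∀ t < T, ∀ i e, v t i e ∈ Set.Icc (0 : ℝ) 1) (a : ℕ → Allocation n m) {t : ℕ}
    (ht : t ≤ T) (i : Fin n) (e : Fin m) : 0 ≤ ucb C v a t i e :=
  add_nonneg (empMean_mem_Icc hv a ht i e).1 (rad_nonneg hC _ _)

/-- Each of the three summands of the bound is at most 1 once C samples are available;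
multiplicative weights needs such bounded gains. -/
theorem ucb_le_three {C : ℝ} {v : ℕ → Fin n → Fin m → ℝ} {T : ℕ}
    (hv : ∀ t < T, ∀ i e, v t i e ∈ Set.Icc (0 : ℝ) 1) (a : ℕ → Allocation n m) {t : ℕ}
    (ht : t ≤ T) (i : Fin n) (e : Fin m) (hN : C ≤ count a t i e) : ucb C v a t i e ≤ 3 := by
  have h := empMean_mem_Icc hv a ht i e
  have h1 : C / count a t i e ≤ 1 := div_le_one_of_le₀ hN (Nat.cast_nonneg _)
  have h2 : √(C * empMean v a t i e / count a t i e) ≤ 1 := by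
    rw [Real.sqrt_le_one, mul_div_right_comm]
    exact mul_le_one₀ h1 h.1 h.2
  unfold ucb rad
  linarith [h.2]

/-- The lower clean inequality, divided by the count N, is exactly this: √(C·(S/N)/N) = √(CS)/N. -/
theorem IsClean.le_ucb {C : ℝ} {T : ℕ} {μ : Fin n → Fin m → ℝ} {v : ℕ → Fin n → Fin m → ℝ}
    {a : ℕ → Allocation n m} (h : IsClean C T μ v a) {t : ℕ} (ht : t ≤ T) (i : Fin n)
    (e : Fin m) (hN : 1 ≤ count a t i e) : μ i e ≤ ucb C v a t i e := by
  have hN' : (0 : ℝ) < count a t i e := by exact_mod_cast hN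
  have h1 := (h t ht i e).1
  unfold ucb rad
  rw [empMean_eq]
  have h2 : √(C * (sampleSum v a t i e / count a t i e) / count a t i e)
      = √(C * sampleSum v a t i e) / count a t i e := by
    rw [← mul_div_assoc, div_div, Real.sqrt_div' _ (by positivity), Real.sqrt_mul_self hN'.le]
  rw [h2, ← add_div, ← add_div, le_div_iff₀ hN']
  linarith

/-- One √(C/N) is the sampling error of the empirical mean; the other is the first term of the
radius, with the mean bounded by 1. -/
theorem IsClean.ucb_le {C : ℝ} {T : ℕ} {μ : Fin n → Fin m → ℝ} {v : ℕ → Fin n → Fin m → ℝ}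
    {a : ℕ → Allocation n m} (h : IsClean C T μ v a) (hC : 0 ≤ C)
    (hv : ∀ t < T, ∀ i e, v t i e ∈ Set.Icc (0 : ℝ) 1) {t : ℕ} (ht : t ≤ T) (i : Fin n)
    (e : Fin m) (hN : 1 ≤ count a t i e) :
    ucb C v a t i e ≤ μ i e + (2 * √C * √(1 / count a t i e) + C * (1 / count a t i e)) := by
  have hN' : (0 : ℝ) < count a t i e := by exact_mod_cast hN
  have h1 := (h t ht i e).2
  have h3 : √C * √(1 / count a t i e) = √(C * (1 / count a t i e)) := (Real.sqrt_mul hC _).symm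
  have h4 : empMean v a t i e ≤ μ i e + √C * √(1 / count a t i e) := by
    rw [empMean_eq, div_le_iff₀ hN', add_mul, Real.sqrt_div zero_le_one, Real.sqrt_one]
    rw [Real.sqrt_mul hC] at h1
    have : √C * (1 / √(count a t i e)) * count a t i e = √C * √(count a t i e) := by
      have h0 : √(count a t i e : ℝ) ≠ 0 := (Real.sqrt_pos.2 hN').ne'
      field_simp
      rw [Real.sq_sqrt hN'.le]
    rw [this]
    linarith
  have h5 : √(C * empMean v a t i e / count a t i e) ≤ √C * √(1 / count a t i e) := by
    rw [h3]
    apply Real.sqrt_le_sqrt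
    rw [mul_one_div]
    gcongr
    exact mul_le_of_le_one_right hC (empMean_mem_Icc hv a ht i e).2
  unfold ucb rad
  rw [mul_one_div]
  linarith

theorem IsClean.ucbUtility_le {C : ℝ} {T : ℕ} {μ : Fin n → Fin m → ℝ}
    {v : ℕ → Fin n → Fin m → ℝ} {a : ℕ → Allocation n m} (h : IsClean C T μ v a) (hC : 0 ≤ C)
    (hT : 1 ≤ T) (hv : ∀ t < T, ∀ i e, v t i e ∈ Set.Icc (0 : ℝ) 1) (hμ : ∀ i e, 0 ≤ μ i e)
    (hN : ∀ t, n ≤ t → t ≤ T → ∀ i e, 1 ≤ count a t i e) (i : Fin n) :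
    ucbUtility C v a T i ≤ ∑ t ∈ Finset.range T, ∑ e, μ i e * (a t).mat i e
      + (4 * (m * √(C * T)) + m * C * (1 + Real.log T)) := by
  have hg : ∀ k : ℕ, (0 : ℝ) ≤ 2 * √C * √(1 / (k : ℝ)) + C * (1 / (k : ℝ)) := fun k => by
    positivity
  unfold ucbUtility
  rw [sum_sum_mul_mat, sum_sum_mul_mat _ (fun _ => μ)]
  calc _ ≤ ∑ e, (∑ t ∈ (Finset.range T).filter (fun t => a t e = i), μ i e
          + (4 * √(C * T) + C * (1 + Real.log T))) := by
        refine Finset.sum_le_sum fun e _ => ?_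
        calc _ ≤ ∑ t ∈ (Finset.Ico n T).filter (fun t => a t e = i), (μ i e +
              (2 * √C * √(1 / count a t i e) + C * (1 / count a t i e))) := by
              refine Finset.sum_le_sum fun t ht => ?_
              simp only [Finset.mem_filter, Finset.mem_Ico] at ht
              exact h.ucb_le hC hv ht.1.2.le i e (hN t ht.1.1 ht.1.2.le i e)
          _ ≤ _ := by
              rw [Finset.sum_add_distrib]
              refine add_le_add ?_ ((sum_filter_Ico_count_le a i e hg n T).trans ?_)
              · refine Finset.sum_le_sum_of_subset_of_nonneg ?_ fun _ _ _ => hμ i e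
                exact Finset.filter_subset_filter _ fun t ht => by
                  simp only [Finset.mem_Ico, Finset.mem_range] at ht ⊢; exact ht.2
              · rw [Finset.sum_add_distrib, ← Finset.mul_sum, ← Finset.mul_sum, Real.sqrt_mul hC]
                have h1 := sum_range_inv_sqrt_le T
                have h2 := sum_range_inv_le hT
                have h3 := mul_le_mul_of_nonneg_left h1 (by positivity : 0 ≤ 2 * √C)
                have h4 := mul_le_mul_of_nonneg_left h2 hC
                linarith
    _ = _ := by
        rw [Finset.sum_add_distrib]
        simp only [Finset.sum_const, Finset.card_univ, Fintype.card_fin, nsmul_eq_mul]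
        ring

theorem IsExecution.one_le_count {ε C : ℝ} {T : ℕ} {v : ℕ → Fin n → Fin m → ℝ}
    {a : ℕ → Allocation n m} (h : IsExecution ε C T v a) (hT : n ≤ T) {t : ℕ} (ht : n ≤ t)
    (i : Fin n) (e : Fin m) : 1 ≤ count a t i e := by
  refine Finset.card_pos.2 ⟨i, ?_⟩
  simp only [Finset.mem_filter, Finset.mem_range]
  exact ⟨by omega, h.initial i (by omega) i.2 e⟩

/-- For each pair (i, e) the count takes every value below C at most once along the rounds
allocating e to i, hence at most ⌈C⌉ ≤ C + 1 such rounds. -/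
theorem card_filter_count_lt_le {C : ℝ} (hC : 0 ≤ C) (a : ℕ → Allocation n m) (r T : ℕ) :
    ∑ t ∈ Finset.Ico r T,
      (((Finset.univ : Finset (Fin m)).filter fun e => (count a t (a t e) e : ℝ) < C).card : ℝ)
      ≤ n * m * (C + 1) := by
  have key : ∀ (i : Fin n) (e : Fin m),
      ∑ t ∈ (Finset.Ico r T).filter (fun t => a t e = i),
        (if (count a t i e : ℝ) < C then (1 : ℝ) else 0) ≤ C + 1 := fun i e => by
    refine (sum_filter_Ico_count_le a i e (g := fun k => if (k : ℝ) < C then 1 else 0)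
      (fun k => by split_ifs <;> norm_num) r T).trans ?_
    rw [← Finset.sum_filter, Finset.sum_const, nsmul_eq_mul, mul_one]
    calc _ ≤ ((Finset.range ⌈C⌉₊).card : ℝ) := by
          exact_mod_cast Finset.card_le_card fun k hk => by
            simp only [Finset.mem_filter, Finset.mem_range] at hk ⊢
            exact Nat.lt_ceil.2 hk.2
      _ ≤ C + 1 := by simpa using (Nat.ceil_lt_add_one hC).le
  calc _ = ∑ t ∈ Finset.Ico r T, ∑ e : Fin m, ∑ i : Fin n,
        (if (count a t i e : ℝ) < C then (1 : ℝ) else 0) * (a t).mat i e := by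
        refine Finset.sum_congr rfl fun t _ => ?_
        rw [Finset.card_filter]
        push_cast
        refine Finset.sum_congr rfl fun e _ => ?_
        rw [sum_mul_mat]
    _ = ∑ i : Fin n, ∑ t ∈ Finset.Ico r T, ∑ e : Fin m,
        (if (count a t i e : ℝ) < C then (1 : ℝ) else 0) * (a t).mat i e := by
        symm
        rw [Finset.sum_comm]
        refine Finset.sum_congr rfl fun t _ => ?_
        rw [Finset.sum_comm]
    _ = ∑ i : Fin n, ∑ e : Fin m, ∑ t ∈ (Finset.Ico r T).filter (fun t => a t e = i),
        (if (count a t i e : ℝ) < C then (1 : ℝ) else 0) := by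
        refine Finset.sum_congr rfl fun i _ => ?_
        rw [sum_sum_mul_mat _ (fun t i e => if (count a t i e : ℝ) < C then (1 : ℝ) else 0)]
    _ ≤ ∑ _i : Fin n, ∑ _e : Fin m, (C + 1) :=
        Finset.sum_le_sum fun i _ => Finset.sum_le_sum fun e _ => key i e
    _ = _ := by simp; ring

/-! ### Multiplicative weights -/

/-- For y ≤ 3 the quadratic remainder (εy)²/2 is at most (3/2)ε²y. -/
theorem exp_neg_mul_le_linear {ε L y : ℝ} (hε : 0 ≤ ε) (hL : ε ≤ L) (hy : 0 ≤ y) (hy3 : y ≤ 3) :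
    Real.exp (-(L * y)) ≤ 1 - ε * (1 - 3 / 2 * ε) * y := by
  have h1 : Real.exp (-(L * y)) ≤ Real.exp (-(ε * y)) :=
    Real.exp_le_exp.2 (neg_le_neg (mul_le_mul_of_nonneg_right hL hy))
  have h2 := exp_neg_le_quadratic (mul_nonneg hε hy)
  nlinarith [mul_nonneg (mul_nonneg (sq_nonneg ε) hy) (sub_nonneg.2 hy3)]

/-- One round of multiplicative weights, in which the gains may be large for the items in `bad`. -/
theorem multiplicative_weights_step (hm : 1 ≤ m) {ε L V : ℝ} (hε : 0 ≤ ε) (hε2 : ε ≤ 1 / 2)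
    (hL : ε ≤ L) {w : Fin n → ℝ} (hw : ∀ j, 0 ≤ w j) {y μ q : Fin n → Fin m → ℝ}
    {b : Allocation n m} (hopt : ∀ j e, w j * y j e ≤ w (b e) * y (b e) e)
    (hy : ∀ j e, 0 ≤ y j e)
    (hμy : ∀ j e, μ j e ≤ y j e) (hμ1 : ∀ j e, μ j e ≤ 1)
    (hq0 : ∀ j e, 0 ≤ q j e) (hq1 : ∀ e, ∑ j, q j e = 1) (hV : ∀ j, V ≤ ∑ e, μ j e * q j e)
    {bad : Finset (Fin m)} (hbad : ∀ e ∉ bad, y (b e) e ≤ 3) :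
    ∑ j, w j * Real.exp (-(L * (1 / (m : ℝ) * ∑ e, y j e * b.mat j e)))
      ≤ (∑ j, w j) * (1 - ε * (1 - 3 / 2 * ε) / m * (V - bad.card)) := by
  have hm' : (0 : ℝ) < m := by exact_mod_cast hm
  have hε' : 0 ≤ ε * (1 - 3 / 2 * ε) := mul_nonneg hε (by linarith)
  set δ := ε * (1 - 3 / 2 * ε) with hδ
  set W := ∑ j, w j with hW
  -- Convexity of exp separates the items; the exponent 1/m in the weights supplies the averaging.
  have hjensen : ∀ j, Real.exp (-(L * (1 / (m : ℝ) * ∑ e, y j e * b.mat j e)))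
      ≤ ∑ e, 1 / (m : ℝ) * Real.exp (-(L * (y j e * b.mat j e))) := fun j => by
    have := convexOn_exp.map_sum_le (t := Finset.univ) (w := fun _ : Fin m => 1 / (m : ℝ))
      (p := fun e => -(L * (y j e * b.mat j e))) (fun _ _ => by positivity)
      (by simp [hm'.ne']) (fun _ _ => Set.mem_univ _)
    simp only [smul_eq_mul] at this
    refine le_trans (le_of_eq ?_) this
    congr 1
    simp only [Finset.mul_sum, ← Finset.sum_neg_distrib]
    exact Finset.sum_congr rfl fun e _ => by ring
  have hitem : ∀ e, ∑ j, w j * Real.exp (-(L * (y j e * b.mat j e)))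
      ≤ W - δ * ∑ j, w j * (μ j e * q j e) + δ * (if e ∈ bad then W else 0) := fun e => by
    have h1 : ∑ j, w j * Real.exp (-(L * (y j e * b.mat j e)))
        = W - w (b e) * (1 - Real.exp (-(L * y (b e) e))) := by
      rw [← sum_mul_mat (fun j => w j * (1 - Real.exp (-(L * y j e)))) b e, hW,
        ← Finset.sum_sub_distrib]
      refine Finset.sum_congr rfl fun j _ => ?_
      unfold Allocation.mat
      split_ifs
      · rw [mul_one]; ring
      · simp
    rw [h1]
    split_ifs with he
    -- For a bad item the gain is only known to be nonnegative; the allowance δW covers the missing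
    -- progress, since ∑ wμq ≤ W.
    · have h2 : ∑ j, w j * (μ j e * q j e) ≤ W := by
        refine Finset.sum_le_sum fun j _ => mul_le_of_le_one_right (hw j) ?_
        refine mul_le_one₀ (hμ1 j e) (hq0 j e) ?_
        rw [← hq1 e]
        exact Finset.single_le_sum (f := fun j => q j e) (fun j _ => hq0 j e) (Finset.mem_univ j)
      have h3 : Real.exp (-(L * y (b e) e)) ≤ 1 :=
        Real.exp_le_one_iff.2 (neg_nonpos.2 (mul_nonneg (hε.trans hL) (hy _ _)))
      have h4 := mul_nonneg (hw (b e)) (sub_nonneg.2 h3)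
      have h5 := mul_le_mul_of_nonneg_left h2 hε'
      linarith
    -- Optimism replaces μ by y; the greedy recipient then beats any average with weights q.
    · have h2 : ∑ j, w j * (μ j e * q j e) ≤ w (b e) * y (b e) e := by
        calc _ ≤ ∑ j, w (b e) * y (b e) e * q j e := by
              refine Finset.sum_le_sum fun j _ => ?_
              rw [← mul_assoc]
              refine mul_le_mul_of_nonneg_right ?_ (hq0 j e)
              exact (mul_le_mul_of_nonneg_left (hμy j e) (hw j)).trans (hopt j e)
          _ = _ := by rw [← Finset.mul_sum, hq1, mul_one]
      have h3 := exp_neg_mul_le_linear hε hL (hy (b e) e) (hbad e he)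
      rw [← hδ] at h3
      have h4 := mul_le_mul_of_nonneg_left h3 (hw (b e))
      have h5 := mul_le_mul_of_nonneg_left h2 hε'
      linarith
  calc _ ≤ ∑ j, w j * ∑ e, 1 / (m : ℝ) * Real.exp (-(L * (y j e * b.mat j e))) :=
        Finset.sum_le_sum fun j _ => mul_le_mul_of_nonneg_left (hjensen j) (hw j)
    _ = 1 / (m : ℝ) * ∑ e, ∑ j, w j * Real.exp (-(L * (y j e * b.mat j e))) := by
        rw [Finset.sum_comm, Finset.mul_sum]
        refine Finset.sum_congr rfl fun j _ => ?_
        rw [Finset.mul_sum, Finset.mul_sum]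
        exact Finset.sum_congr rfl fun e _ => by ring
    _ ≤ 1 / (m : ℝ) *
          ∑ e, (W - δ * ∑ j, w j * (μ j e * q j e) + δ * (if e ∈ bad then W else 0)) := by
        gcongr with e _
        exact hitem e
    _ = 1 / (m : ℝ) * (m * W - δ * ∑ j, w j * ∑ e, μ j e * q j e + δ * (bad.card * W)) := by
        congr 1
        have hswap : ∑ j, w j * ∑ e, μ j e * q j e = ∑ e, ∑ j, w j * (μ j e * q j e) := by
          simp only [Finset.mul_sum]
          exact Finset.sum_comm
        rw [hswap, Finset.sum_add_distrib, Finset.sum_sub_distrib, ← Finset.mul_sum,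
          ← Finset.mul_sum, ← Finset.sum_filter]
        simp
    _ ≤ 1 / (m : ℝ) * (m * W - δ * (W * V) + δ * (bad.card * W)) := by
        gcongr
        rw [hW, Finset.sum_mul]
        exact Finset.sum_le_sum fun j _ => mul_le_mul_of_nonneg_left (hV j) (hw j)
    _ = _ := by field_simp; ring

theorem objective_eq (ε C : ℝ) (v : ℕ → Fin n → Fin m → ℝ) (a : ℕ → Allocation n m) (t : ℕ)
    (b : Allocation n m) :
    objective ε C v a t b
      = ∑ e, (1 - ε) ^ (1 / (m : ℝ) * ucbUtility C v a t (b e)) * ucb C v a t (b e) e := by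
  unfold objective
  rw [Finset.sum_comm]
  exact Finset.sum_congr rfl fun e _ => sum_mul_mat
    (fun i => (1 - ε) ^ (1 / (m : ℝ) * ucbUtility C v a t i) * ucb C v a t i e) b e

/-- Reassigning the single item e changes only one summand of the objective, so optimality holds
item by item. -/
theorem IsExecution.weighted_ucb_le {ε C : ℝ} {T : ℕ} {v : ℕ → Fin n → Fin m → ℝ}
    {a : ℕ → Allocation n m} (h : IsExecution ε C T v a) (hε : ε < 1) {t : ℕ} (ht : t < T)
    (hnt : n ≤ t) (j : Fin n) (e : Fin m) :
    (1 - ε) ^ (1 / (m : ℝ) * ucbUtility C v a t j) * ucb C v a t j e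
      ≤ (1 - ε) ^ (1 / (m : ℝ) * ucbUtility C v a t (a t e)) * ucb C v a t (a t e) e := by
  have h1 := h.later t ht hnt hε (Function.update (a t) e j)
  rw [objective_eq, objective_eq, ← Finset.add_sum_erase _ _ (Finset.mem_univ e),
    ← Finset.add_sum_erase (a := e) _
      (fun e => (1 - ε) ^ (1 / (m : ℝ) * ucbUtility C v a t (a t e)) * ucb C v a t (a t e) e)
      (Finset.mem_univ e)] at h1
  rw [Finset.sum_congr rfl (fun e' he' => by
    rw [Function.update_of_ne (Finset.ne_of_mem_erase he')]), Function.update_self] at h1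
  exact le_of_add_le_add_right h1

theorem ucbUtility_succ (C : ℝ) (v : ℕ → Fin n → Fin m → ℝ) (a : ℕ → Allocation n m) {t : ℕ}
    (ht : n ≤ t) (i : Fin n) :
    ucbUtility C v a (t + 1) i
      = ucbUtility C v a t i + ∑ e, ucb C v a t i e * (a t).mat i e := by
  unfold ucbUtility
  rw [Finset.sum_Ico_succ_top ht]

theorem ucbUtility_nonneg {C : ℝ} (hC : 0 ≤ C) {v : ℕ → Fin n → Fin m → ℝ} {T : ℕ}
    (hv : ∀ t < T, ∀ i e, v t i e ∈ Set.Icc (0 : ℝ) 1) (a : ℕ → Allocation n m) (i : Fin n) :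
    0 ≤ ucbUtility C v a T i :=
  Finset.sum_nonneg fun _ hs => Finset.sum_nonneg fun e _ =>
    mul_nonneg (ucb_nonneg hC hv a (Finset.mem_Ico.1 hs).2.le i e) (mat_nonneg _ _ _)

/-- The number of items allocated in round `t` to an agent with few samples for them. -/
noncomputable def rareCount (C : ℝ) (a : ℕ → Allocation n m) (t : ℕ) : ℕ :=
  ((Finset.univ : Finset (Fin m)).filter fun e => (count a t (a t e) e : ℝ) < C).card

/-- Induction over rounds: the one-round factor 1 - z is at most exp(-z), whatever the sign of z.
With L = -log(1-ε) the terms on the left are the algorithm's weights. -/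
theorem IsExecution.potential_le {ε C L V : ℝ} {T : ℕ} {v : ℕ → Fin n → Fin m → ℝ}
    {a : ℕ → Allocation n m} (h : IsExecution ε C T v a) (hm : 1 ≤ m) (hnT : n ≤ T)
    (hε : 0 ≤ ε) (hε2 : ε ≤ 1 / 2) (hL : L = -Real.log (1 - ε)) (hC : 0 ≤ C)
    (hv : ∀ t < T, ∀ i e, v t i e ∈ Set.Icc (0 : ℝ) 1) {μ q : Fin n → Fin m → ℝ}
    (hclean : IsClean C T μ v a) (hμ : ∀ i e, μ i e ∈ Set.Icc (0 : ℝ) 1)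
    (hq0 : ∀ j e, 0 ≤ q j e) (hq1 : ∀ e, ∑ j, q j e = 1) (hV : ∀ j, V ≤ ∑ e, μ j e * q j e)
    {t : ℕ} (hnt : n ≤ t) (htT : t ≤ T) :
    ∑ i, Real.exp (-(L * (1 / (m : ℝ) * ucbUtility C v a t i)))
      ≤ n * Real.exp (-(ε * (1 - 3 / 2 * ε) / m *
          (((t : ℝ) - n) * V - ∑ s ∈ Finset.Ico n t, (rareCount C a s : ℝ)))) := by
  have hεL : ε ≤ L := by
    have := Real.log_le_sub_one_of_pos (by linarith : 0 < 1 - ε)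
    linarith
  have hpow : ∀ x, (1 - ε) ^ x = Real.exp (-(L * x)) := fun x => by
    rw [Real.rpow_def_of_pos (by linarith), hL]; ring_nf
  induction t, hnt using Nat.le_induction with
  | base => simp [ucbUtility]
  | succ t hnt ih =>
    have ht : t < T := htT
    have hopt := h.weighted_ucb_le (by linarith) ht hnt
    simp only [hpow] at hopt
    have hstep := multiplicative_weights_step hm hε hε2 hεL
      (w := fun j => Real.exp (-(L * (1 / (m : ℝ) * ucbUtility C v a t j))))
      (fun _ => (Real.exp_pos _).le) hopt (fun j e => ucb_nonneg hC hv a ht.le j e)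
      (fun j e => hclean.le_ucb ht.le j e (h.one_le_count hnT hnt j e))
      (fun j e => (hμ j e).2) hq0 hq1 hV
      (bad := Finset.univ.filter fun e => (count a t (a t e) e : ℝ) < C)
      (fun e he => ucb_le_three hv a ht.le _ e (by simpa using he))
    calc _ = ∑ j, Real.exp (-(L * (1 / (m : ℝ) * ucbUtility C v a t j))) *
          Real.exp (-(L * (1 / (m : ℝ) * ∑ e, ucb C v a t j e * (a t).mat j e))) := by
          refine Finset.sum_congr rfl fun j _ => ?_
          rw [ucbUtility_succ C v a hnt, ← Real.exp_add]
          ring_nf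
      _ ≤ _ := hstep
      _ ≤ (n * Real.exp (-(ε * (1 - 3 / 2 * ε) / m *
          (((t : ℝ) - n) * V - ∑ s ∈ Finset.Ico n t, (rareCount C a s : ℝ))))) *
          Real.exp (-(ε * (1 - 3 / 2 * ε) / m * (V - rareCount C a t))) := by
          refine (mul_le_mul_of_nonneg_left ?_
            (Finset.sum_nonneg fun _ _ => (Real.exp_pos _).le)).trans
            (mul_le_mul_of_nonneg_right (ih ht.le) (Real.exp_pos _).le)
          rw [sub_eq_neg_add]
          exact Real.add_one_le_exp _
      _ = _ := by
          rw [mul_assoc, ← Real.exp_add, Finset.sum_Ico_succ_top hnt]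
          push_cast
          ring_nf

theorem neg_log_one_sub_le {ε : ℝ} (hε2 : ε ≤ 1 / 2) :
    -Real.log (1 - ε) ≤ ε * (1 + 2 * ε) := by
  have h0 : 0 < 1 - ε := by linarith
  rw [← Real.log_inv]
  refine (Real.log_le_sub_one_of_pos (inv_pos.2 h0)).trans ?_
  rw [sub_le_iff_le_add, inv_le_iff_one_le_mul₀ h0]
  -- (1 + ε(1+2ε))(1-ε) = 1 + ε²(1-2ε).
  nlinarith [mul_nonneg (sq_nonneg ε) (by linarith : 0 ≤ 1 - 2 * ε)]

theorem IsExecution.le_ucbUtility {ε C : ℝ} {T : ℕ} {v : ℕ → Fin n → Fin m → ℝ}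
    {a : ℕ → Allocation n m} (h : IsExecution ε C T v a) (hn : 1 ≤ n) (hm : 1 ≤ m) (hnT : n ≤ T)
    (hε : 0 < ε) (hε2 : ε ≤ 1 / 2) (hC : 0 ≤ C)
    (hv : ∀ t < T, ∀ i e, v t i e ∈ Set.Icc (0 : ℝ) 1) {μ : Fin n → Fin m → ℝ}
    (hclean : IsClean C T μ v a) (hμ : ∀ i e, μ i e ∈ Set.Icc (0 : ℝ) 1)
    (x : ℕ → Allocation n m) (i : Fin n) :
    welfare T (fun _ => μ) x
      ≤ ucbUtility C v a T i + (m + 7 / 2 * (m * (ε * T / n)) + n * m * (C + 1)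
        + m * (Real.log n / ε)) := by
  have : NeZero n := ⟨by omega⟩
  have hm' : (0 : ℝ) < m := by exact_mod_cast hm
  have hn' : (0 : ℝ) < n := by exact_mod_cast hn
  have hT' : (0 : ℝ) < T := by exact_mod_cast (by omega : 0 < T)
  have hnT' : (n : ℝ) ≤ T := by exact_mod_cast hnT
  set O := welfare T (fun _ => μ) x with hO
  have hOmem : O ∈ Set.Icc 0 ((m : ℝ) * T / n) := welfare_mem_Icc (fun _ _ => hμ) x
  -- The comparator q is the time average of x, which guarantees every agent V = O/T per round.
  have hpot := h.potential_le (L := -Real.log (1 - ε)) (V := O / T) (μ := μ)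
    (q := fun j e => 1 / (T : ℝ) * ∑ t ∈ Finset.range T, (x t).mat j e)
    hm hnT hε.le hε2 rfl hC hv hclean hμ
    (fun j e => mul_nonneg (by positivity) (Finset.sum_nonneg fun _ _ => mat_nonneg _ _ _))
    (fun e => by
      rw [← Finset.mul_sum, Finset.sum_comm]
      simp [sum_mat, hT'.ne'])
    (fun j => by
      rw [div_le_iff₀ hT', Finset.sum_mul]
      refine (BMMFA.welfare_le T (fun _ => μ) x j).trans (le_of_eq ?_)
      rw [Finset.sum_comm]
      refine Finset.sum_congr rfl fun e _ => ?_
      rw [← Finset.mul_sum]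
      field_simp)
    hnT le_rfl
  set R := ∑ s ∈ Finset.Ico n T, (rareCount C a s : ℝ) with hR
  have hRle : R ≤ n * m * (C + 1) := card_filter_count_lt_le hC a n T
  have hR0 : 0 ≤ R := Finset.sum_nonneg fun _ _ => Nat.cast_nonneg _
  set u := ucbUtility C v a T i with hu
  have hu0 : 0 ≤ u := ucbUtility_nonneg hC hv a i
  have hsingle := (Finset.single_le_sum
    (f := fun i => Real.exp (-(-Real.log (1 - ε) * (1 / (m : ℝ) * ucbUtility C v a T i))))
    (fun _ _ => (Real.exp_pos _).le) (Finset.mem_univ i)).trans hpot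
  have hlog := Real.log_le_log (Real.exp_pos _) hsingle
  rw [Real.log_mul hn'.ne' (Real.exp_pos _).ne', Real.log_exp, Real.log_exp] at hlog
  set X := ((T : ℝ) - n) * (O / T) with hX
  have hX0 : 0 ≤ X := mul_nonneg (by linarith) (div_nonneg hOmem.1 hT'.le)
  have h1 : ε * (1 - 3 / 2 * ε) * (X - R) - m * Real.log n ≤ -Real.log (1 - ε) * u := by
    have h2 := mul_le_mul_of_nonneg_left hlog hm'.le
    have h3 : (m : ℝ) * -(-Real.log (1 - ε) * (1 / m * u)) = -(-Real.log (1 - ε) * u) := by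
      field_simp
    have h4 : (m : ℝ) * (Real.log n + -(ε * (1 - 3 / 2 * ε) / m * (X - R)))
        = m * Real.log n - ε * (1 - 3 / 2 * ε) * (X - R) := by
      field_simp
      ring
    rw [← hu, h3, h4] at h2
    linarith
  have h2 := h1.trans (mul_le_mul_of_nonneg_right (neg_log_one_sub_le hε2) hu0)
  set Q := Real.log n / ε with hQ
  have hQε : Real.log n = ε * Q := by rw [hQ]; field_simp
  have hQ0 : 0 ≤ Q := div_nonneg (Real.log_natCast_nonneg n) hε.le
  have h3 : (1 - 3 / 2 * ε) * (X - R) - m * Q ≤ (1 + 2 * ε) * u := by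
    rw [hQε] at h2
    refine le_of_mul_le_mul_left ?_ hε
    linarith
  -- (1 - 7ε/2)(1 + 2ε) = 1 - 3ε/2 - 7ε² ≤ 1 - 3ε/2.
  have h4 : (1 - 7 / 2 * ε) * X - R - m * Q ≤ u := by
    refine le_of_mul_le_mul_left (a := 1 + 2 * ε) ?_ (by linarith)
    have := mul_nonneg hm'.le hQ0
    nlinarith [mul_nonneg hε.le hR0, mul_nonneg hε.le this, mul_nonneg (sq_nonneg ε) hX0]
  have h5 : X = O - n * (O / T) := by rw [hX]; field_simp
  -- The n initial rounds, which do not enter the potential, cost at most m.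
  have h6 : n * (O / T) ≤ m := by
    have := hOmem.2
    rw [le_div_iff₀ hn'] at this
    rw [← mul_div_assoc, div_le_iff₀ hT']
    linarith
  have h7 : ε * X ≤ m * (ε * T / n) := by
    have h8 : X ≤ m * T / n := by
      have := mul_nonneg hn'.le (div_nonneg hOmem.1 hT'.le)
      linarith [hOmem.2]
    calc ε * X ≤ ε * (m * T / n) := mul_le_mul_of_nonneg_left h8 hε.le
      _ = _ := by ring
  linarith

/-! ### Tail exponents -/

/-- Here A is the mean of the sum. The hypothesis forces S ≤ A - √(CA)/2, and the Chernoff exponent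
at δ = √(C/A)/2 is at least δ√(CA)/2 - Aδ²/2 = C/4 - C/8. -/
theorem lower_tail_exponent {C A S : ℝ} (hC : 0 < C) (hS : 0 ≤ S) (h : S + √(C * S) + C < A) :
    C / 8 ≤ -(√(C / A) / 2) * S - A * (Real.exp (-(√(C / A) / 2)) - 1) := by
  have hCA : C < A := by linarith [Real.sqrt_nonneg (C * S)]
  have hA : 0 < A := hC.trans hCA
  have hAle : √(C * A) ≤ A := by
    rw [Real.sqrt_le_left hA.le]
    nlinarith
  have hSle : S ≤ A - √(C * A) / 2 := by
    -- Otherwise S > A/2, so √(CS) ≥ √(CA)/2 and S + √(CS) > A.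
    by_contra! hcon
    have h1 : A / 2 < S := by linarith
    have h2 : √(C * A) / 2 ≤ √(C * S) := by
      refine Real.le_sqrt_of_sq_le ?_
      rw [div_pow, Real.sq_sqrt (by positivity)]
      nlinarith
    linarith
  set δ := √(C / A) / 2 with hδ
  have hδ0 : 0 ≤ δ := by positivity
  have h1 : δ * √(C * A) = C / 2 := by
    rw [hδ, div_mul_eq_mul_div, ← Real.sqrt_mul (by positivity),
      show C / A * (C * A) = C * C by field_simp, Real.sqrt_mul_self hC.le]
  have h2 : A * δ ^ 2 = C / 4 := by
    rw [hδ, div_pow, Real.sq_sqrt (by positivity)]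
    field_simp
    norm_num
  have h3 := mul_le_mul_of_nonneg_left (exp_neg_le_quadratic hδ0) hA.le
  have h4 := mul_le_mul_of_nonneg_left hSle hδ0
  linarith

/-- S ≤ k forces C < k, hence δ ≤ 1 and exp δ - 1 ≤ δ + δ². The exponent is then at least δ√(Ck) -
kμδ² ≥ C/2 - C/4. -/
theorem upper_tail_exponent {C μ S k : ℝ} (hC : 0 < C) (hμ : μ ∈ Set.Icc (0 : ℝ) 1)
    (hk : 0 ≤ k) (hS : S ≤ k) (h : k * μ + √(C * k) < S) :
    C / 8 ≤ √(C / k) / 2 * S - k * μ * (Real.exp (√(C / k) / 2) - 1) := by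
  have h0 : √(C * k) < k := by nlinarith [mul_nonneg hk hμ.1]
  have hk0 : 0 < k := (Real.sqrt_nonneg _).trans_lt h0
  have hCk : C < k := by
    rw [Real.sqrt_lt' hk0] at h0
    nlinarith
  set δ := √(C / k) / 2 with hδ
  have hδ0 : 0 ≤ δ := by positivity
  have hδ1 : δ ≤ 1 := by
    have : √(C / k) ≤ 1 := by
      rw [Real.sqrt_le_one]
      exact (div_le_one hk0).2 hCk.le
    linarith
  have h1 : δ * √(C * k) = C / 2 := by
    rw [hδ, div_mul_eq_mul_div, ← Real.sqrt_mul (by positivity),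
      show C / k * (C * k) = C * C by field_simp, Real.sqrt_mul_self hC.le]
  have h2 : k * δ ^ 2 = C / 4 := by
    rw [hδ, div_pow, Real.sq_sqrt (by positivity)]
    field_simp
    norm_num
  have h3 : Real.exp δ - 1 ≤ δ + δ ^ 2 := by
    have := (abs_le.1 (Real.abs_exp_sub_one_sub_id_le (abs_le.2 ⟨by linarith, hδ1⟩))).2
    linarith
  have h4 := mul_le_mul_of_nonneg_left h3 (mul_nonneg hk hμ.1)
  have h5 := mul_le_mul_of_nonneg_left h.le hδ0
  have h6 : k * μ * δ ^ 2 ≤ C / 4 := by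
    rw [mul_right_comm, h2]
    exact mul_le_of_le_one_right (by positivity) hμ.2
  nlinarith

/-- On [0,1] convexity gives exp(lz) ≤ 1 + z(exp l - 1); integrate and use 1 + x ≤ exp x. -/
theorem lintegral_exp_mul_le (D : Measure ℝ) [IsProbabilityMeasure D]
    (hD : ∀ᵐ z ∂D, z ∈ Set.Icc (0 : ℝ) 1) (l : ℝ) :
    ∫⁻ z, ENNReal.ofReal (Real.exp (l * z)) ∂D
      ≤ ENNReal.ofReal (Real.exp ((∫ z, z ∂D) * (Real.exp l - 1))) := by
  have hint : Integrable (fun z : ℝ => z) D :=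
    Integrable.of_mem_Icc 0 1 aemeasurable_id hD
  have hint' : Integrable (fun z : ℝ => 1 + z * (Real.exp l - 1)) D :=
    (integrable_const 1).add (hint.mul_const _)
  calc _ ≤ ∫⁻ z, ENNReal.ofReal (1 + z * (Real.exp l - 1)) ∂D := by
        refine lintegral_mono_ae ?_
        filter_upwards [hD] with z hz
        refine ENNReal.ofReal_le_ofReal ?_
        have := convexOn_exp.2 (Set.mem_univ 0) (Set.mem_univ l) (sub_nonneg.2 hz.2) hz.1 (by ring)
        simp only [smul_eq_mul, mul_zero, zero_add, Real.exp_zero, mul_one] at this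
        rw [mul_comm l z]
        linarith
    _ = ENNReal.ofReal (∫ z, 1 + z * (Real.exp l - 1) ∂D) := by
        rw [ofReal_integral_eq_lintegral_ofReal hint']
        filter_upwards [hD] with z hz
        have := mul_nonneg hz.1 (Real.exp_pos l).le
        simp only [Pi.zero_apply]
        linarith [hz.2]
    _ = ENNReal.ofReal (1 + (∫ z, z ∂D) * (Real.exp l - 1)) := by
        rw [integral_add (integrable_const 1) (hint.mul_const _), integral_mul_const]
        simp
    _ ≤ _ := ENNReal.ofReal_le_ofReal (by
        rw [add_comm]
        exact Real.add_one_le_exp _)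

/-! ### Adaptedness and independence -/

/-- On the π-system of sets s ∩ t generating the join, P(s ∩ t ∩ u) = P(s)P(t ∩ u) = P(s)P(t)P(u).
-/
theorem indep_sup_left_of_indep {Ω : Type*} {𝒢 A B mΩ : MeasurableSpace Ω} {P : Measure Ω}
    [IsProbabilityMeasure P] (hG : 𝒢 ≤ mΩ) (hA : A ≤ mΩ) (hB : B ≤ mΩ)
    (h : Indep 𝒢 (A ⊔ B) P) (hAB : Indep A B P) : Indep (𝒢 ⊔ A) B P := by
  rw [Indep_iff] at h hAB
  have hgen : 𝒢 ⊔ A = MeasurableSpace.generateFrom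
      {u | ∃ s t, MeasurableSet[𝒢] s ∧ MeasurableSet[A] t ∧ u = s ∩ t} := by
    refine le_antisymm (sup_le ?_ ?_) (MeasurableSpace.generateFrom_le ?_)
    · exact fun s hs => MeasurableSpace.measurableSet_generateFrom
        ⟨s, Set.univ, hs, MeasurableSet.univ, by simp⟩
    · exact fun s hs => MeasurableSpace.measurableSet_generateFrom
        ⟨Set.univ, s, MeasurableSet.univ, hs, by simp⟩
    · rintro _ ⟨s, t, hs, ht, rfl⟩
      exact MeasurableSet.inter ((le_sup_left : 𝒢 ≤ 𝒢 ⊔ A) s hs) ((le_sup_right : A ≤ 𝒢 ⊔ A) t ht)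
  refine IndepSets.indep (p2 := {s | MeasurableSet[B] s}) (sup_le hG hA) hB ?_
    (@MeasurableSpace.isPiSystem_measurableSet _ B) hgen
    (@MeasurableSpace.generateFrom_measurableSet _ B).symm ?_
  · rintro _ ⟨s, t, hs, ht, rfl⟩ _ ⟨s', t', hs', ht', rfl⟩ -
    exact ⟨s ∩ s', t ∩ t', hs.inter hs', ht.inter ht', Set.inter_inter_inter_comm s t s' t'⟩
  · rw [IndepSets_iff]
    rintro _ u ⟨s, t, hs, ht, rfl⟩ hu
    have htu : MeasurableSet[A ⊔ B] (t ∩ u) :=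
      MeasurableSet.inter ((le_sup_left : A ≤ A ⊔ B) t ht) ((le_sup_right : B ≤ A ⊔ B) u hu)
    rw [Set.inter_assoc, h s _ hs htu, hAB t u ht hu,
      h s t hs ((le_sup_left : A ≤ A ⊔ B) t ht), mul_assoc]

/-- The information available before round `t` when all values of the earlier rounds are revealed,
given internal randomness `𝒢`. -/
@[reducible] def past {Ω : Type*} (𝒢 : MeasurableSpace Ω) (v : ℕ → Fin n → Fin m → Ω → ℝ) (T t : ℕ) :
    MeasurableSpace Ω :=
  𝒢 ⊔ ⨆ p ∈ {p : Fin T × Fin n × Fin m | p.1.val < t},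
    MeasurableSpace.comap (v p.1 p.2.1 p.2.2) inferInstance

theorem past_mono {Ω : Type*} (𝒢 : MeasurableSpace Ω) (v : ℕ → Fin n → Fin m → Ω → ℝ) (T : ℕ)
    {s t : ℕ} (h : s ≤ t) : past 𝒢 v T s ≤ past 𝒢 v T t :=
  sup_le_sup_left (biSup_mono fun _ hp => lt_of_lt_of_le hp h) _

theorem measurable_value_past {Ω : Type*} (𝒢 : MeasurableSpace Ω)
    (v : ℕ → Fin n → Fin m → Ω → ℝ) {T s t : ℕ} (hs : s < T) (hst : s < t) (i : Fin n)
    (e : Fin m) : Measurable[past 𝒢 v T t] (v s i e) := by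
  rw [measurable_iff_comap_le]
  exact le_sup_of_le_right
    (le_biSup (fun p : Fin T × Fin n × Fin m => MeasurableSpace.comap (v p.1 p.2.1 p.2.2) _)
      (show (⟨s, hs⟩, i, e) ∈ {p : Fin T × Fin n × Fin m | p.1.val < t} from hst))

theorem measurable_apply_choice {Ω : Type*} [MeasurableSpace Ω] {c : Ω → Fin n}
    (hc : Measurable c) {f : Fin n → Ω → ℝ} (hf : ∀ i, Measurable (f i)) :
    Measurable fun ω => f (c ω) ω := by
  have : (fun ω => f (c ω) ω) = fun ω => ∑ i, if c ω = i then f i ω else 0 := by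
    ext ω; simp
  rw [this]
  exact Finset.measurable_sum _ fun i _ =>
    Measurable.ite (hc (measurableSet_singleton i)) (hf i) measurable_const

/-- Observed feedback is a choice, made by an earlier allocation, among earlier values. Enlarging
the history to all earlier values keeps it independent of round t. -/
theorem measurable_past_of_history {Ω : Type*} {𝒢 : MeasurableSpace Ω}
    {v : ℕ → Fin n → Fin m → Ω → ℝ} {a : ℕ → Ω → Allocation n m} {T : ℕ}
    (h : ∀ t < T, Measurable[𝒢 ⊔ history v a t] (a t)) :
    ∀ t < T, Measurable[past 𝒢 v T t] (a t) := by
  intro t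
  induction t using Nat.strong_induction_on with
  | _ t ih =>
    intro ht
    refine (h t ht).mono (sup_le le_sup_left ?_) le_rfl
    refine iSup₂_le fun s hs => sup_le ?_ ?_
    · rw [← measurable_iff_comap_le]
      exact (ih s hs (hs.trans ht)).mono (past_mono 𝒢 v T hs.le) le_rfl
    · rw [← measurable_iff_comap_le]
      have ha := (ih s hs (hs.trans ht)).mono (past_mono 𝒢 v T hs.le) le_rfl
      refine @measurable_pi_lambda _ _ _ (past 𝒢 v T t) _ _ fun e => ?_
      exact @measurable_apply_choice n Ω (past 𝒢 v T t) _
        ((measurable_pi_apply e).comp ha) (fun i => v s i e)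
        fun i => measurable_value_past 𝒢 v (hs.trans ht) hs i e

theorem measurable_sampleSum {Ω : Type*} [MeasurableSpace Ω] {v : ℕ → Fin n → Fin m → Ω → ℝ}
    {a : ℕ → Ω → Allocation n m} {t : ℕ} (ha : ∀ s < t, Measurable (a s))
    (hv : ∀ s < t, ∀ i e, Measurable (v s i e)) (i : Fin n) (e : Fin m) :
    Measurable fun ω => sampleSum (fun t i e => v t i e ω) (fun t => a t ω) t i e := by
  induction t with
  | zero => simp [sampleSum]
  | succ t ih =>
    simp only [sampleSum_succ]
    refine (ih (fun s hs => ha s (by omega)) (fun s hs => hv s (by omega))).add ?_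
    exact Measurable.ite (((measurable_pi_apply e).comp (ha t (by omega)))
      (measurableSet_singleton i)) (hv t (by omega) i e) measurable_const

theorem measurable_count {Ω : Type*} [MeasurableSpace Ω] {a : ℕ → Ω → Allocation n m} {t : ℕ}
    (ha : ∀ s < t, Measurable (a s)) (i : Fin n) (e : Fin m) :
    Measurable fun ω => (count (fun t => a t ω) t i e : ℝ) := by
  have := measurable_sampleSum (v := fun _ _ _ _ => 1) ha (fun _ _ _ _ => measurable_const) i e
  simpa [sampleSum, count] using this

theorem IsValueModel.indep_past {Ω : Type*} {𝒢 mΩ : MeasurableSpace Ω} {P : Measure Ω}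
    [IsProbabilityMeasure P] {T : ℕ} {D : Fin n → Fin m → Measure ℝ}
    {v : ℕ → Fin n → Fin m → Ω → ℝ} (hM : IsValueModel P T D v)
    (hG : 𝒢 ≤ mΩ) (hind : Indep 𝒢 (⨆ p : Fin T × Fin n × Fin m,
      MeasurableSpace.comap (v p.1 p.2.1 p.2.2) inferInstance) P) {t : ℕ} (ht : t < T)
    (i : Fin n) (e : Fin m) :
    Indep (past 𝒢 v T t) (MeasurableSpace.comap (v t i e) inferInstance) P := by
  have hle : ∀ p : Fin T × Fin n × Fin m,
      MeasurableSpace.comap (v p.1 p.2.1 p.2.2) inferInstance ≤ mΩ := fun p =>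
    (hM.measurable p.1 p.1.2 p.2.1 p.2.2).comap_le
  set p₀ : Fin T × Fin n × Fin m := (⟨t, ht⟩, i, e) with hp₀
  have hdisj : Disjoint {p : Fin T × Fin n × Fin m | p.1.val < t} {p₀} := by
    rw [Set.disjoint_singleton_right]
    simp [hp₀]
  have h1 := indep_iSup_of_disjoint hle hM.indep hdisj
  rw [iSup_singleton] at h1
  refine indep_sup_left_of_indep hG (iSup₂_le fun p _ => hle p) (hle p₀) ?_ h1
  refine indep_of_indep_of_le_right hind (sup_le (iSup₂_le fun p _ => ?_) ?_)
  · exact le_iSup (fun p : Fin T × Fin n × Fin m =>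
      MeasurableSpace.comap (v p.1 p.2.1 p.2.2) inferInstance) p
  · exact le_iSup (fun p : Fin T × Fin n × Fin m =>
      MeasurableSpace.comap (v p.1 p.2.1 p.2.2) inferInstance) p₀

theorem past_le {Ω : Type*} {𝒢 mΩ : MeasurableSpace Ω} {P : Measure Ω} {T : ℕ}
    {D : Fin n → Fin m → Measure ℝ} {v : ℕ → Fin n → Fin m → Ω → ℝ} (hM : IsValueModel P T D v)
    (hG : 𝒢 ≤ mΩ) (t : ℕ) : past 𝒢 v T t ≤ mΩ :=
  sup_le hG (iSup₂_le fun p _ => (hM.measurable p.1 p.1.2 p.2.1 p.2.2).comap_le)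

/-! ### The exponential supermartingale -/

/-- The exponential weight controlling the samples of `(i, e)`. -/
noncomputable def expWeight (l κ : ℝ) (v : ℕ → Fin n → Fin m → ℝ) (a : ℕ → Allocation n m)
    (t : ℕ) (i : Fin n) (e : Fin m) : ENNReal :=
  ENNReal.ofReal (Real.exp (l * sampleSum v a t i e - count a t i e * κ))

/-- The new sample enters only as a factor multiplying a quantity fixed by the past, so independence
applies directly, without conditional expectations. -/
theorem expWeight_succ (l κ : ℝ) (v : ℕ → Fin n → Fin m → ℝ) (a : ℕ → Allocation n m)
    (t : ℕ) (i : Fin n) (e : Fin m) :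
    expWeight l κ v a (t + 1) i e
      = (if a t e = i then 0 else expWeight l κ v a t i e)
        + (if a t e = i then expWeight l κ v a t i e else 0)
          * ENNReal.ofReal (Real.exp (l * v t i e - κ)) := by
  unfold expWeight
  rw [sampleSum_succ, count_succ]
  split_ifs
  · rw [zero_add, ← ENNReal.ofReal_mul (Real.exp_pos _).le, ← Real.exp_add]
    push_cast
    ring_nf
  · simp

theorem measurable_expWeight {Ω : Type*} [MeasurableSpace Ω] {v : ℕ → Fin n → Fin m → Ω → ℝ}
    {a : ℕ → Ω → Allocation n m} {t : ℕ} (ha : ∀ s < t, Measurable (a s))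
    (hv : ∀ s < t, ∀ i e, Measurable (v s i e)) (l κ : ℝ) (i : Fin n) (e : Fin m) :
    Measurable fun ω => expWeight l κ (fun t i e => v t i e ω) (fun t => a t ω) t i e :=
  ENNReal.measurable_ofReal.comp (Real.measurable_exp.comp
    (((measurable_sampleSum ha hv i e).const_mul l).sub ((measurable_count ha i e).mul_const κ)))

theorem IsValueModel.lintegral_expWeight_le {Ω : Type*} {𝒢 mΩ : MeasurableSpace Ω}
    {P : Measure Ω} [IsProbabilityMeasure P] {T : ℕ} {D : Fin n → Fin m → Measure ℝ}
    {v : ℕ → Fin n → Fin m → Ω → ℝ} (hM : IsValueModel P T D v) {a : ℕ → Ω → Allocation n m}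
    (hG : 𝒢 ≤ mΩ) (hind : Indep 𝒢 (⨆ p : Fin T × Fin n × Fin m,
      MeasurableSpace.comap (v p.1 p.2.1 p.2.2) inferInstance) P)
    (ha : ∀ t < T, Measurable[past 𝒢 v T t] (a t)) (l : ℝ) (i : Fin n) (e : Fin m) {t : ℕ}
    (ht : t ≤ T) :
    ∫⁻ ω, expWeight l (meanValue D i e * (Real.exp l - 1)) (fun t i e => v t i e ω)
      (fun t => a t ω) t i e ∂P ≤ 1 := by
  set κ := meanValue D i e * (Real.exp l - 1) with hκ
  induction t with
  | zero => simp [expWeight, sampleSum, count]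
  | succ t ih =>
    have ht' : t < T := ht
    have hle := past_le hM hG t
    have haT : ∀ s < t, Measurable[past 𝒢 v T t] (a s) := fun s hs =>
      (ha s (hs.trans ht')).mono (past_mono 𝒢 v T hs.le) le_rfl
    have hX := @measurable_expWeight n m Ω (past 𝒢 v T t) v a t haT
      (fun s hs i e => measurable_value_past 𝒢 v (hs.trans ht') hs i e) l κ i e
    have hset : MeasurableSet[past 𝒢 v T t] {ω | a t ω e = i} :=
      ((measurable_pi_apply e).comp (ha t ht')) (measurableSet_singleton i)
    have hX1 : Measurable[past 𝒢 v T t] fun ω => if a t ω e = i then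
        expWeight l κ (fun t i e => v t i e ω) (fun t => a t ω) t i e else 0 :=
      Measurable.ite hset hX (@measurable_const _ _ _ (past 𝒢 v T t) _)
    have hX0 : Measurable[past 𝒢 v T t] fun ω => if a t ω e = i then 0 else
        expWeight l κ (fun t i e => v t i e ω) (fun t => a t ω) t i e :=
      Measurable.ite hset (@measurable_const _ _ _ (past 𝒢 v T t) _) hX
    have hg : Measurable fun z : ℝ => ENNReal.ofReal (Real.exp (l * z - κ)) := by fun_prop
    -- The compensator κ is the bound on the log moment generating function, so one new sample has
    -- mean factor at most 1.
    have hY : ∫⁻ ω, ENNReal.ofReal (Real.exp (l * v t i e ω - κ)) ∂P ≤ 1 := by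
      have := hM.isProb i e
      have h1 := lintegral_exp_mul_le (D i e) (hM.mem_Icc i e) l
      calc _ = ∫⁻ z, ENNReal.ofReal (Real.exp (l * z - κ)) ∂(D i e) := by
            rw [← hM.law t ht' i e, lintegral_map hg (hM.measurable t ht' i e)]
        _ = (∫⁻ z, ENNReal.ofReal (Real.exp (l * z)) ∂(D i e)) *
              ENNReal.ofReal (Real.exp (-κ)) := by
            rw [← lintegral_mul_const _ (by fun_prop)]
            refine lintegral_congr fun z => ?_
            rw [← ENNReal.ofReal_mul (Real.exp_pos _).le, ← Real.exp_add, sub_eq_add_neg]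
        _ ≤ ENNReal.ofReal (Real.exp κ) * ENNReal.ofReal (Real.exp (-κ)) := by gcongr; exact h1
        _ = 1 := by
            rw [← ENNReal.ofReal_mul (Real.exp_pos _).le, ← Real.exp_add]
            simp
    simp only [expWeight_succ]
    calc _ = (∫⁻ ω, (if a t ω e = i then 0 else expWeight l κ (fun t i e => v t i e ω)
            (fun t => a t ω) t i e) ∂P)
          + (∫⁻ ω, (if a t ω e = i then expWeight l κ (fun t i e => v t i e ω)
            (fun t => a t ω) t i e else 0) ∂P)
            * ∫⁻ ω, ENNReal.ofReal (Real.exp (l * v t i e ω - κ)) ∂P := by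
          rw [lintegral_add_left, lintegral_mul_eq_lintegral_mul_lintegral_of_independent_measurableSpace hle
            (hM.measurable t ht' i e).comap_le (hM.indep_past hG hind ht' i e)]
          · exact hX1
          · exact hg.comp (comap_measurable _)
          · exact hX0.mono hle le_rfl
      _ ≤ (∫⁻ ω, (if a t ω e = i then 0 else expWeight l κ (fun t i e => v t i e ω)
            (fun t => a t ω) t i e) ∂P)
          + (∫⁻ ω, (if a t ω e = i then expWeight l κ (fun t i e => v t i e ω)
            (fun t => a t ω) t i e else 0) ∂P) := by
          gcongr
          exact mul_le_of_le_one_right' hY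
      _ = ∫⁻ ω, expWeight l κ (fun t i e => v t i e ω) (fun t => a t ω) t i e ∂P := by
          rw [← lintegral_add_left]
          · refine lintegral_congr fun ω => ?_
            split_ifs <;> simp
          · exact hX0.mono hle le_rfl
      _ ≤ 1 := ih ht'.le

/-! ### The clean event -/

/-- The suitable rate l depends on the random count. Letting k range over all possible counts keeps
each rate deterministic, as the supermartingale requires. -/
theorem exp_le_expWeight_of_not_isClean {C : ℝ} (hC : 0 < C) {T : ℕ} {μ : Fin n → Fin m → ℝ}
    (hμ : ∀ i e, μ i e ∈ Set.Icc (0 : ℝ) 1) {v : ℕ → Fin n → Fin m → ℝ}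
    (hv : ∀ t < T, ∀ i e, v t i e ∈ Set.Icc (0 : ℝ) 1) {a : ℕ → Allocation n m}
    (h : ¬ IsClean C T μ v a) :
    ∃ t ≤ T, ∃ k ≤ T, ∃ i e, ∃ l ∈ ({-(√(C / (k * μ i e)) / 2), √(C / k) / 2} : Set ℝ),
      ENNReal.ofReal (Real.exp (C / 8)) ≤ expWeight l (μ i e * (Real.exp l - 1)) v a t i e := by
  unfold IsClean at h
  push Not at h
  obtain ⟨t, ht, i, e, h⟩ := h
  refine ⟨t, ht, count a t i e, (count_le a t i e).trans ht, i, e, ?_⟩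
  unfold expWeight
  by_cases h1 : count a t i e * μ i e ≤ sampleSum v a t i e + √(C * sampleSum v a t i e) + C
  · refine ⟨_, Or.inr rfl, ENNReal.ofReal_le_ofReal (Real.exp_le_exp.2 ?_)⟩
    refine (upper_tail_exponent hC (hμ i e) (Nat.cast_nonneg _)
      (sampleSum_le_count hv a ht i e) (h h1)).trans (le_of_eq ?_)
    ring
  · refine ⟨_, Or.inl rfl, ENNReal.ofReal_le_ofReal (Real.exp_le_exp.2 ?_)⟩
    refine (lower_tail_exponent hC (sampleSum_nonneg hv a ht i e) (not_le.1 h1)).trans (le_of_eq ?_)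
    ring

theorem IsValueModel.ae_mem_Icc {Ω : Type*} [MeasurableSpace Ω] {P : Measure Ω} {T : ℕ}
    {D : Fin n → Fin m → Measure ℝ} {v : ℕ → Fin n → Fin m → Ω → ℝ} (hM : IsValueModel P T D v) :
    ∀ᵐ ω ∂P, ∀ t < T, ∀ i e, v t i e ω ∈ Set.Icc (0 : ℝ) 1 := by
  have : ∀ t, ∀ᵐ ω ∂P, t < T → ∀ i e, v t i e ω ∈ Set.Icc (0 : ℝ) 1 := fun t => by
    by_cases ht : t < T
    · simp only [ht, true_imp_iff, ae_all_iff]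
      intro i e
      refine ae_of_ae_map (hM.measurable t ht i e).aemeasurable ?_
      rw [hM.law t ht i e]
      exact hM.mem_Icc i e
    · simp [ht]
  exact ae_all_iff.2 this

theorem IsValueModel.meanValue_mem_Icc {Ω : Type*} [MeasurableSpace Ω] {P : Measure Ω} {T : ℕ}
    {D : Fin n → Fin m → Measure ℝ} {v : ℕ → Fin n → Fin m → Ω → ℝ} (hM : IsValueModel P T D v)
    (i : Fin n) (e : Fin m) : meanValue D i e ∈ Set.Icc (0 : ℝ) 1 := by
  have := hM.isProb i e
  have hint : Integrable (fun z : ℝ => z) (D i e) :=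
    Integrable.of_mem_Icc 0 1 aemeasurable_id (hM.mem_Icc i e)
  constructor
  · exact integral_nonneg_of_ae ((hM.mem_Icc i e).mono fun z hz => hz.1)
  · have := integral_mono_ae hint (integrable_const (1 : ℝ))
      ((hM.mem_Icc i e).mono fun z hz => hz.2)
    simpa [meanValue] using this

theorem IsValueModel.exists_isClean_of_indep {Ω : Type*} {𝒢 mΩ : MeasurableSpace Ω}
    {P : Measure Ω} [IsProbabilityMeasure P] {T : ℕ} {D : Fin n → Fin m → Measure ℝ}
    {v : ℕ → Fin n → Fin m → Ω → ℝ} (hM : IsValueModel P T D v) {a : ℕ → Ω → Allocation n m}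
    (hG : 𝒢 ≤ mΩ) (hind : Indep 𝒢 (⨆ p : Fin T × Fin n × Fin m,
      MeasurableSpace.comap (v p.1 p.2.1 p.2.2) inferInstance) P)
    (ha : ∀ t < T, Measurable[past 𝒢 v T t] (a t)) {C : ℝ} (hC : 0 < C) :
    ∃ B : Set Ω, MeasurableSet B ∧
      P B ≤ ENNReal.ofReal (2 * n * m * (T + 1) ^ 2 * Real.exp (-(C / 8))) ∧
      ∀ᵐ ω ∂P, ω ∉ B → IsClean C T (meanValue D) (fun t i e => v t i e ω) (fun t => a t ω) := by
  have ha' : ∀ t < T, Measurable (a t) := fun t ht => (ha t ht).mono (past_le hM hG t) le_rfl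
  set rate : ℕ → Fin n → Fin m → Bool → ℝ := fun k i e s =>
    if s then √(C / k) / 2 else -(√(C / (k * meanValue D i e)) / 2) with hrate
  set E : Fin (T + 1) × Fin (T + 1) × Fin n × Fin m × Bool → Set Ω := fun p =>
    {ω | ENNReal.ofReal (Real.exp (C / 8)) ≤
      expWeight (rate p.2.1 p.2.2.1 p.2.2.2.1 p.2.2.2.2)
        (meanValue D p.2.2.1 p.2.2.2.1 * (Real.exp (rate p.2.1 p.2.2.1 p.2.2.2.1 p.2.2.2.2) - 1))
        (fun t i e => v t i e ω) (fun t => a t ω) p.1 p.2.2.1 p.2.2.2.1} with hE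
  have hmeas : ∀ (p : Fin (T + 1) × Fin (T + 1) × Fin n × Fin m × Bool), Measurable fun ω =>
      expWeight (rate p.2.1 p.2.2.1 p.2.2.2.1 p.2.2.2.2)
        (meanValue D p.2.2.1 p.2.2.2.1 * (Real.exp (rate p.2.1 p.2.2.1 p.2.2.2.1 p.2.2.2.2) - 1))
        (fun t i e => v t i e ω) (fun t => a t ω) p.1 p.2.2.1 p.2.2.2.1 := fun p =>
    measurable_expWeight (fun s hs => ha' s (by omega))
      (fun s hs i e => hM.measurable s (by omega) i e) _ _ _ _
  -- Markov's inequality for a weight of mean at most 1.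
  have hPE : ∀ p, P (E p) ≤ ENNReal.ofReal (Real.exp (-(C / 8))) := fun p => by
    refine (meas_ge_le_lintegral_div (hmeas p).aemeasurable
      (ENNReal.ofReal_pos.2 (Real.exp_pos _)).ne' ENNReal.ofReal_ne_top).trans ?_
    rw [Real.exp_neg, ENNReal.ofReal_inv_of_pos (Real.exp_pos _), ← one_div]
    exact ENNReal.div_le_div_right (hM.lintegral_expWeight_le hG hind ha _ _ _ (by omega)) _
  refine ⟨⋃ p, E p, MeasurableSet.iUnion fun p => measurableSet_le measurable_const (hmeas p), ?_,
    ?_⟩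
  · calc P (⋃ p, E p) ≤ ∑ p, P (E p) := measure_iUnion_fintype_le _ _
      _ ≤ ∑ _p : Fin (T + 1) × Fin (T + 1) × Fin n × Fin m × Bool,
            ENNReal.ofReal (Real.exp (-(C / 8))) := Finset.sum_le_sum fun p _ => hPE p
      _ = _ := by
          rw [Finset.sum_const, nsmul_eq_mul, ← ENNReal.ofReal_natCast,
            ← ENNReal.ofReal_mul (Nat.cast_nonneg _)]
          simp only [Finset.card_univ, Fintype.card_prod, Fintype.card_fin, Fintype.card_bool]
          push_cast
          ring_nf
  · filter_upwards [hM.ae_mem_Icc] with ω hω hB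
    by_contra hcon
    obtain ⟨t, ht, k, hk, i, e, l, hl, hle⟩ :=
      exp_le_expWeight_of_not_isClean hC hM.meanValue_mem_Icc hω hcon
    refine hB (Set.mem_iUnion.2 ?_)
    rcases hl with rfl | rfl
    · exact ⟨(⟨t, by omega⟩, ⟨k, by omega⟩, i, e, false), by simpa [hE, hrate] using hle⟩
    · exact ⟨(⟨t, by omega⟩, ⟨k, by omega⟩, i, e, true), by simpa [hE, hrate] using hle⟩

theorem IsValueModel.exists_isClean {Ω : Type*} {mΩ : MeasurableSpace Ω} {P : Measure Ω}
    [IsProbabilityMeasure P] {T : ℕ} {D : Fin n → Fin m → Measure ℝ}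
    {v : ℕ → Fin n → Fin m → Ω → ℝ} (hM : IsValueModel P T D v) {a : ℕ → Ω → Allocation n m}
    (hA : IsNonanticipating P T v a) {C : ℝ} (hC : 0 < C) :
    ∃ B : Set Ω, MeasurableSet B ∧
      P B ≤ ENNReal.ofReal (2 * n * m * (T + 1) ^ 2 * Real.exp (-(C / 8))) ∧
      ∀ᵐ ω ∂P, ω ∉ B → IsClean C T (meanValue D) (fun t i e => v t i e ω) (fun t => a t ω) := by
  obtain ⟨𝒢, hG, hind, hhist⟩ := hA
  exact hM.exists_isClean_of_indep hG hind (measurable_past_of_history hhist) hC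

/-! ### The regret bound -/

/-- Lets the clean event be applied to the optimal policy as well. -/
theorem isNonanticipating_const {Ω : Type*} [MeasurableSpace Ω] (P : Measure Ω)
    [IsProbabilityMeasure P] (T : ℕ) (v : ℕ → Fin n → Fin m → Ω → ℝ) (x : ℕ → Allocation n m) :
    IsNonanticipating P T v (fun t _ => x t) :=
  ⟨⊥, bot_le, indep_bot_left _, fun _ _ => @measurable_const _ _ _ _ _⟩

theorem IsExecution.abs_welfare_sub_le {ε C : ℝ} {T : ℕ} {v : ℕ → Fin n → Fin m → ℝ}
    {x a : ℕ → Allocation n m} {μ : Fin n → Fin m → ℝ} (h : IsExecution ε C T v a) (hn : 1 ≤ n)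
    (hm : 1 ≤ m) (hnT : n ≤ T) (hε : 0 < ε) (hε2 : ε ≤ 1 / 2) (hC : 0 ≤ C)
    (hv : ∀ t < T, ∀ i e, v t i e ∈ Set.Icc (0 : ℝ) 1) (hμ : ∀ i e, μ i e ∈ Set.Icc (0 : ℝ) 1)
    (hx : IsOptimalPolicy T μ x) (hcx : IsClean C T μ v x) (hca : IsClean C T μ v a) :
    |welfare T v x - welfare T v a| ≤ 6 * (m * √(C * T)) + m * C * (2 + Real.log T) + m
      + 7 / 2 * (m * (ε * T / n)) + n * m * (C + 1) + m * (Real.log n / ε) := by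
  have : NeZero n := ⟨by omega⟩
  have hlogT := Real.log_natCast_nonneg T
  have hlogn := div_nonneg (Real.log_natCast_nonneg n) hε.le
  have h1 := hcx.welfare_le hC
  have h2 := hcx.le_welfare hC hv
  have h3 := hca.welfare_le hC
  have h4 := hx a
  -- Of the factor 5, four come from the confidence radii and one from passing from means to
  -- realized values; the realized welfare of x adds the sixth.
  have h5 : welfare T (fun _ => μ) x - (5 * (m * √(C * T)) + m * C * (2 + Real.log T) + m
      + 7 / 2 * (m * (ε * T / n)) + n * m * (C + 1) + m * (Real.log n / ε)) ≤ welfare T v a := by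
    refine le_welfare fun i => ?_
    have h6 := h.le_ucbUtility hn hm hnT hε hε2 hC hv hca hμ x i
    have h7 := hca.ucbUtility_le hC (hn.trans hnT) hv (fun i e => (hμ i e).1)
      (fun t ht _ i e => h.one_le_count hnT ht i e) i
    have h8 := hca.le_agent hC hv i
    linarith
  have h9 : 0 ≤ m * √(C * T) := by positivity
  have h10 : 0 ≤ m * C * (1 + Real.log T) := by positivity
  have h11 : 0 ≤ m * C := by positivity
  have h12 : (0 : ℝ) ≤ m + 7 / 2 * (m * (ε * T / n)) + n * m * (C + 1) + m * (Real.log n / ε) := by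
    positivity
  rw [abs_le]
  constructor <;> linarith

/-- The bound on the regret, up to a constant factor. -/
noncomputable def regretBound (n m T : ℕ) (C : ℝ) : ℝ :=
  (m : ℝ) * √((T : ℝ) * Real.log n / n) + (m : ℝ) * √((T : ℝ) * Real.log T)
    + (√(C * (m : ℝ) ^ 2 * T) + C * (m : ℝ) * Real.log T)

theorem sqrt_mul_sq_mul (C : ℝ) (m T : ℕ) : √(C * (m : ℝ) ^ 2 * T) = m * √(C * T) := by
  rw [mul_right_comm, mul_comm, Real.sqrt_mul (by positivity), Real.sqrt_sq (Nat.cast_nonneg m)]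

theorem half_le_log_natCast {T : ℕ} (hT : 2 ≤ T) : 1 / 2 ≤ Real.log T := by
  have h1 : Real.log 2 ≤ Real.log T :=
    Real.log_le_log (by norm_num) (by exact_mod_cast hT)
  linarith [Real.log_two_gt_d9]

theorem natCast_le_mul_sqrt_mul_log {T : ℕ} (hT : 2 ≤ T) (m : ℕ) :
    (m : ℝ) ≤ m * √((T : ℝ) * Real.log T) := by
  refine le_mul_of_one_le_right (Nat.cast_nonneg m) (Real.one_le_sqrt.2 ?_)
  have hT' : (2 : ℝ) ≤ T := by exact_mod_cast hT
  nlinarith [half_le_log_natCast hT]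

/-- The trivial bound suffices in both cases: ε > 1/2 means T < 4n log n, so T/n ≤ 2√(T log n/n),
and T < n²C gives T/n ≤ √(CT). -/
theorem mul_div_le_regretBound {T : ℕ} {C : ℝ} (hn : 2 ≤ n) (hnT : n ≤ T)
    (hC : 0 ≤ C)
    (h : 1 / 2 < √((n : ℝ) * Real.log n / T) ∨ (T : ℝ) < (n : ℝ) ^ 2 * C) :
    (m : ℝ) * T / n ≤ 2 * regretBound n m T C := by
  have hn' : (0 : ℝ) < n := by exact_mod_cast (by omega : 0 < n)
  have hT' : (0 : ℝ) < T := by exact_mod_cast (by omega : 0 < T)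
  have hlogT := Real.log_natCast_nonneg T
  have h1 : 0 ≤ (m : ℝ) * √((T : ℝ) * Real.log n / n) := by positivity
  have h2 : 0 ≤ (m : ℝ) * √((T : ℝ) * Real.log T) := by positivity
  have h3 : 0 ≤ (m : ℝ) * √(C * T) := by positivity
  have h4 : 0 ≤ C * (m : ℝ) * Real.log T := by positivity
  unfold regretBound
  rw [sqrt_mul_sq_mul, mul_div_assoc]
  rcases h with h | h
  · rw [Real.lt_sqrt (by norm_num), lt_div_iff₀ hT'] at h
    have h5 : (T : ℝ) / n ≤ 2 * √((T : ℝ) * Real.log n / n) := by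
      rw [← div_le_iff₀' (by norm_num)]
      refine Real.le_sqrt_of_sq_le ?_
      rw [div_pow, div_pow, le_div_iff₀ hn', div_div, div_mul_eq_mul_div, div_le_iff₀ (by positivity)]
      nlinarith [mul_le_mul_of_nonneg_left h.le (by positivity : (0 : ℝ) ≤ T * n)]
    have := mul_le_mul_of_nonneg_left h5 (Nat.cast_nonneg (α := ℝ) m)
    linarith
  · have h5 : (T : ℝ) / n ≤ √(C * T) := by
      refine Real.le_sqrt_of_sq_le ?_
      rw [div_pow, div_le_iff₀ (by positivity)]
      nlinarith
    have := mul_le_mul_of_nonneg_left h5 (Nat.cast_nonneg (α := ℝ) m)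
    linarith

/-- For this ε, both εT/n and log n/ε equal √(T log n/n), while n²C ≤ T absorbs nC into √(CT). -/
theorem error_terms_le_regretBound {T : ℕ} {C : ℝ} (hn : 2 ≤ n) (hnT : n ≤ T)
    (hC : 1 ≤ C) (h : (n : ℝ) ^ 2 * C ≤ T) :
    6 * (m * √(C * T)) + m * C * (2 + Real.log T) + m
      + 7 / 2 * (m * (√((n : ℝ) * Real.log n / T) * T / n)) + n * m * (C + 1)
      + m * (Real.log n / √((n : ℝ) * Real.log n / T)) ≤ 8 * regretBound n m T C := by
  have hn' : (0 : ℝ) < n := by exact_mod_cast (by omega : 0 < n)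
  have hT' : (0 : ℝ) < T := by exact_mod_cast (by omega : 0 < T)
  have hm' : (0 : ℝ) ≤ m := Nat.cast_nonneg m
  have hlogn := half_le_log_natCast hn
  have hlogT := half_le_log_natCast (hn.trans hnT)
  have hlogn' : 0 < Real.log n := by linarith
  have hε : 0 < √((n : ℝ) * Real.log n / T) := Real.sqrt_pos.2 (by positivity)
  have hε2 : √((n : ℝ) * Real.log n / T) ^ 2 = (n : ℝ) * Real.log n / T :=
    Real.sq_sqrt (by positivity)
  set s := √((n : ℝ) * Real.log n / T) with hs
  have hsT : s ^ 2 * T = n * Real.log n := by rw [hε2]; field_simp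
  have h1 : s * T / n = √((T : ℝ) * Real.log n / n) := by
    symm
    rw [Real.sqrt_eq_iff_mul_self_eq (by positivity) (by positivity)]
    field_simp
    linarith
  have h2 : Real.log n / s = √((T : ℝ) * Real.log n / n) := by
    rw [← h1]
    field_simp
    linarith
  have h3 : n * C ≤ √(C * T) := by
    refine Real.le_sqrt_of_sq_le ?_
    nlinarith
  have h4 := mul_le_mul_of_nonneg_left h3 hm'
  have h5 : (n : ℝ) * m * (C + 1) ≤ 2 * (m * (n * C)) := by
    nlinarith [mul_nonneg (mul_nonneg hn'.le hm') (sub_nonneg.2 hC)]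
  have h6 : m * C * (2 + Real.log T) ≤ 5 * (C * m * Real.log T) := by
    nlinarith [mul_nonneg (mul_nonneg hm' (zero_le_one.trans hC)) (sub_nonneg.2 hlogT)]
  have h7 := natCast_le_mul_sqrt_mul_log (hn.trans hnT) m
  have h8 : 0 ≤ (m : ℝ) * √((T : ℝ) * Real.log n / n) := by positivity
  have h9 : 0 ≤ C * m * Real.log T := by positivity
  rw [h1, h2]
  unfold regretBound
  rw [sqrt_mul_sq_mul]
  linarith

theorem failure_term_le {T : ℕ} {C : ℝ} (hn : 2 ≤ n) (hm : 1 ≤ m) (hnT : n ≤ T)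
    (hC : 24 * Real.log ((m : ℝ) * n * T) ≤ C) :
    (m : ℝ) * T / n * (2 * (2 * n * m * ((T : ℝ) + 1) ^ 2 * Real.exp (-(C / 8)))) ≤ 16 * m := by
  have hn' : (1 : ℝ) ≤ n := by exact_mod_cast (by omega : 1 ≤ n)
  have hm' : (1 : ℝ) ≤ m := by exact_mod_cast hm
  have hT' : (1 : ℝ) ≤ T := by exact_mod_cast (by omega : 1 ≤ T)
  have hpos : (0 : ℝ) < m * n * T := by positivity
  -- 24 = 8·3: the third power of mnT cancels the T³ from the union bound and the trivial welfare
  -- bound.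
  have h1 : Real.exp (-(C / 8)) ≤ (((m : ℝ) * n * T) ^ 3)⁻¹ := by
    rw [← Real.exp_log hpos, ← Real.exp_nat_mul, ← Real.exp_neg]
    refine Real.exp_le_exp.2 ?_
    push_cast
    linarith
  have h2 : ((T : ℝ) + 1) ^ 2 ≤ (2 * T) ^ 2 := by gcongr; linarith
  calc _ ≤ (m : ℝ) * T / n * (2 * (2 * n * m * (2 * T) ^ 2 * (((m : ℝ) * n * T) ^ 3)⁻¹)) := by
        gcongr
    _ = 16 * (m * ((m : ℝ) ^ 2 * n ^ 3)⁻¹) := by field_simp; norm_num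
    _ ≤ 16 * m := by
        have : (1 : ℝ) ≤ m ^ 2 * n ^ 3 := one_le_mul_of_one_le_of_one_le (one_le_pow₀ hm')
          (one_le_pow₀ hn')
        gcongr
        exact mul_le_of_le_one_right (by positivity) (inv_le_one_of_one_le₀ this)

theorem abs_regret_le {Ω : Type*} [MeasurableSpace Ω] {P : Measure Ω} {T : ℕ}
    {v : ℕ → Fin n → Fin m → Ω → ℝ} {x : ℕ → Allocation n m} {a : ℕ → Ω → Allocation n m}
    {g : Ω → ℝ} (hg : Integrable g P)
    (h : ∀ᵐ ω ∂P, |welfare T (fun t i e => v t i e ω) x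
      - welfare T (fun t i e => v t i e ω) (fun t => a t ω)| ≤ g ω) :
    |regret P T v x a| ≤ ∫ ω, g ω ∂P := by
  rw [← Real.norm_eq_abs]
  exact norm_integral_le_of_norm_le hg (by simpa only [Real.norm_eq_abs] using h)

theorem IsValueModel.abs_regret_le_regretBound {Ω : Type*} [MeasurableSpace Ω] {P : Measure Ω}
    [IsProbabilityMeasure P] {T : ℕ} {C : ℝ} {D : Fin n → Fin m → Measure ℝ}
    {v : ℕ → Fin n → Fin m → Ω → ℝ} {x : ℕ → Allocation n m} {a : ℕ → Ω → Allocation n m}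
    (hM : IsValueModel P T D v) (hn : 2 ≤ n) (hm : 1 ≤ m) (hnT : n ≤ T)
    (hC : 24 * Real.log ((m : ℝ) * n * T) ≤ C) (hx : IsOptimalPolicy T (meanValue D) x)
    (hA : IsNonanticipating P T v a)
    (hE : ∀ ω, IsExecution (√((n : ℝ) * Real.log n / T)) C T (fun t i e => v t i e ω)
      (fun t => a t ω)) :
    |regret P T v x a| ≤ 24 * regretBound n m T C := by
  have : NeZero n := ⟨by omega⟩
  have hn' : (2 : ℝ) ≤ n := by exact_mod_cast hn
  have hm' : (1 : ℝ) ≤ m := by exact_mod_cast hm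
  have hT' : (2 : ℝ) ≤ T := by exact_mod_cast hn.trans hnT
  have hC1 : 1 ≤ C := by
    have h1 : Real.log 2 ≤ Real.log ((m : ℝ) * n * T) := by
      refine Real.log_le_log (by norm_num) ?_
      have : (2 : ℝ) ≤ m * n := by nlinarith
      nlinarith
    linarith [Real.log_two_gt_d9]
  have hC0 : 0 < C := by linarith
  have hlogT := half_le_log_natCast (hn.trans hnT)
  have hmle : (m : ℝ) ≤ regretBound n m T C := by
    have h1 := natCast_le_mul_sqrt_mul_log (hn.trans hnT) m
    have h2 : 0 ≤ (m : ℝ) * √((T : ℝ) * Real.log n / n) := by positivity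
    have h3 : 0 ≤ √(C * (m : ℝ) ^ 2 * T) := by positivity
    have h4 : 0 ≤ C * (m : ℝ) * Real.log T := by positivity
    unfold regretBound
    linarith
  by_cases htriv : 1 / 2 < √((n : ℝ) * Real.log n / T) ∨ (T : ℝ) < (n : ℝ) ^ 2 * C
  · have h1 := abs_regret_le (x := x) (a := a) (integrable_const ((m : ℝ) * T / n))
      (hM.ae_mem_Icc.mono fun ω hω => BMMFA.abs_welfare_sub_le hω x (fun t => a t ω))
    have h2 := mul_div_le_regretBound (m := m) hn hnT hC0.le htriv
    rw [integral_const, probReal_univ, one_smul] at h1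
    linarith
  push Not at htriv
  have hε : 0 < √((n : ℝ) * Real.log n / T) := by
    have := half_le_log_natCast hn
    exact Real.sqrt_pos.2 (div_pos (mul_pos (by linarith) (by linarith)) (by linarith))
  obtain ⟨B, hB, hPB, hcleanB⟩ := hM.exists_isClean hA hC0
  obtain ⟨B', hB', hPB', hcleanB'⟩ := hM.exists_isClean (isNonanticipating_const P T v x) hC0
  -- Two failure events, for a and for x, each of probability at most p.
  set p := 2 * n * m * ((T : ℝ) + 1) ^ 2 * Real.exp (-(C / 8)) with hp
  have hp0 : 0 ≤ p := by positivity
  have hreal : ∀ {s : Set Ω}, P s ≤ ENNReal.ofReal p → P.real s ≤ p := fun hs =>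
    ENNReal.toReal_le_of_le_ofReal hp0 hs
  have hint : Integrable (fun ω => 8 * regretBound n m T C
      + (B ∪ B').indicator (fun _ => (m : ℝ) * T / n) ω) P :=
    (integrable_const _).add ((integrable_const _).indicator (hB.union hB'))
  have h1 := abs_regret_le (x := x) (a := a) (T := T) (v := v) hint (by
    filter_upwards [hM.ae_mem_Icc, hcleanB, hcleanB'] with ω hω hca hcx
    by_cases hωB : ω ∈ B ∪ B'
    · rw [Set.indicator_of_mem hωB]
      have := BMMFA.abs_welfare_sub_le hω x (fun t => a t ω)
      linarith
    · rw [Set.indicator_of_notMem hωB, add_zero]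
      rw [Set.mem_union, not_or] at hωB
      exact ((hE ω).abs_welfare_sub_le (by omega) hm hnT hε htriv.1 hC0.le hω
        hM.meanValue_mem_Icc hx (hcx hωB.2) (hca hωB.1)).trans
        (error_terms_le_regretBound hn hnT hC1 htriv.2))
  rw [integral_add (integrable_const _) ((integrable_const _).indicator (hB.union hB')),
    integral_const, probReal_univ, one_smul, integral_indicator_const _ (hB.union hB'),
    smul_eq_mul] at h1
  have h2 : P.real (B ∪ B') ≤ 2 * p := by
    linarith [measureReal_union_le (μ := P) B B', hreal hPB, hreal hPB']
  have h3 := failure_term_le hn hm hnT hC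
  have h4 := mul_le_mul_of_nonneg_left h2 (by positivity : 0 ≤ (m : ℝ) * T / n)
  rw [← hp] at h3
  linarith

end BMMFA

theorem theorem2 :
    ∃ c₀ : ℝ, 0 < c₀ ∧ ∀ c : ℝ, c₀ ≤ c → ∃ K : ℝ, 0 < K ∧
      ∀ (n m T : ℕ), 1 ≤ n → 1 ≤ m → n ≤ T →
      ∀ C : ℝ, c₀ * Real.log ((m : ℝ) * n * T) ≤ C → C ≤ c * Real.log ((m : ℝ) * n * T) →
      ∀ (Ω : Type*) [MeasurableSpace Ω] (P : Measure Ω) [IsProbabilityMeasure P]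
        (D : Fin n → Fin m → Measure ℝ) (v : ℕ → Fin n → Fin m → Ω → ℝ)
        (x : ℕ → BMMFA.Allocation n m) (a : ℕ → Ω → BMMFA.Allocation n m),
        BMMFA.IsValueModel P T D v →
        BMMFA.IsOptimalPolicy T (BMMFA.meanValue D) x →
        BMMFA.IsNonanticipating P T v a →
        (∀ ω, BMMFA.IsExecution (√((n : ℝ) * Real.log n / T)) C T
          (fun t i e => v t i e ω) (fun t => a t ω)) →
        |BMMFA.regret P T v x a| ≤
          K * ((m : ℝ) * √((T : ℝ) * Real.log n / n) + (m : ℝ) * √((T : ℝ) * Real.log T)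
            + (√(C * (m : ℝ) ^ 2 * T) + C * (m : ℝ) * Real.log T)) := by
  -- c₀ = 8·3 comes from the failure probability; K = 8 + 16 adds the clean and failure
  -- contributions.
  refine ⟨24, by norm_num, fun c _ => ⟨24, by norm_num, ?_⟩⟩
  intro n m T hn hm hnT C hC _ Ω _ P _ D v x a hM hx hA hE
  -- With one agent ε = 0, but only one allocation exists and the regret vanishes.
  rcases hn.eq_or_lt with rfl | hn
  · have h0 : BMMFA.regret P T v x a = 0 := by
      have hxa : ∀ ω, (fun t => a t ω) = x := fun ω => Subsingleton.elim _ _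
      simp [BMMFA.regret, hxa]
    have hC0 : 0 ≤ C := by
      refine le_trans (mul_nonneg (by norm_num) ?_) hC
      exact_mod_cast Real.log_natCast_nonneg (m * 1 * T)
    have := Real.log_natCast_nonneg T
    rw [h0, abs_zero]
    positivity
  · exact hM.abs_regret_le_regretBound hn hm hnT hC hx hA hE
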